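/- Write $\log_k$ for the $k$-fold iterated logarithm. Fix real constants $0<\gamma<\tfrac12$ and $2<a<1/\gamma$. Let $M$ be a positive integer (large enough that $\log_3 M>0$), let $-D<0$ be a fundamental discriminant, and for each nonzero prime ideal $\mathfrak p$ of the ring of integers of $\mathbb{Q}(\sqrt{-D})$ let $p$ denote the rational prime below $\mathfrak p$; $N$ denotes the ideal norm. For $k=1,2,\dots,\lfloor(\log_2 M)^\gamma\rfloor-1$ let $\mathbb{P}_k$ be the set of prime ideals $\mathfrak p$ with $$e^{k}\log M\log_2 M<p\le e^{k+1}\log M\log_2 M,$$ and let $\mathbb{P}=\bigcup_k\mathbb{P}_k$, so that $\mathbb{P}$ consists of the prime ideals above the primes in $(e\log M\log_2 M,\ \exp(\lfloor(\log_2 M)^\gamma\rfloor)\log M\log_2 M]$. Let $f$ be the multiplicative function on ideals supported on the squarefree ideals all of whose prime factors lie in $\mathbb{P}$, with $$f(\mathfrak p)=\sqrt{\frac{\log M\log_2 M}{\log_3 M}}\cdot\frac{1}{\sqrt p\,(\log p-\log_2 M-\log_3 M)}\qquad(\mathfrak p\in\mathbb{P}),$$ and let $\mathcal{M}$ be the set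 of ideals in the support of $f$ that have, for every $k=1,\dots,\lfloor(\log_2 M)^\gamma\rfloor-1$, fewer than $\dfrac{a\log M}{k^2\log_3 M}$ prime factors in $\mathbb{P}_k$. Then, for all $M$ sufficiently large in terms of $\gamma$ and $a$ only (in particular uniformly in $D$), the set $\mathcal{M}$ has at most $M$ elements. Moreover, when in addition $M\le D$, $$\frac{1}{\sum_{\mathfrak m\in\mathcal{M}}f(\mathfrak m)^2}\sum_{\substack{\mathfrak m,\mathfrak n\in\mathcal{M},\ \mathfrak m\mid\mathfrak n\\ N(\mathfrak n/\mathfrak m)<\sqrt D}}\frac{f(\mathfrak m)f(\mathfrak n)}{\sqrt{N(\mathfrak n/\mathfrak m)}}\ \ge\ \exp\Bigg((1+o(1))\sqrt{\frac{\log M\log_2 M}{\log_3 M}}\sum_{\mathfrak p\in\mathbb{P}}\frac{1}{\sqrt{N\mathfrak p}}\,\frac{1}{\sqrt p\,(\log p-\log_2 M-\log_3 M)}+o(1)\Bigg),$$ where both $o(1)$ terms tend to $0$ as $M\to\infty$ for fixed $\gamma$ and $a$, uniformly in $D$. -/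

import Mathlib

open Filter Topology NumberField

noncomputable section

namespace Resonance

/-- `d` is a fundamental discriminant: either `d ≡ 1 (mod 4)` is squarefree and `d ≠ 1`, or
`d = 4 m` with `m ≡ 2, 3 (mod 4)` squarefree. -/
def IsFundamentalDiscriminant (d : ℤ) : Prop :=
  (d ≠ 1 ∧ d % 4 = 1 ∧ Squarefree d) ∨
    ∃ m : ℤ, d = 4 * m ∧ (m % 4 = 2 ∨ m % 4 = 3) ∧ Squarefree m

/-- `K` is (a model of) the field `ℚ(√-D)`. -/
def IsQSqrtNeg (D : ℕ) (K : Type*) [Field K] [CharZero K] : Prop :=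
  ∃ x : K, x ^ 2 = -(D : K) ∧ IntermediateField.adjoin ℚ {x} = ⊤

/-- The `k`-fold iterated logarithm `log_k`. -/
def iterLog (k : ℕ) (x : ℝ) : ℝ := Real.log^[k] x

/-- The number `⌊(log₂ M) ^ γ⌋`. -/
def shellCount (γ : ℝ) (M : ℕ) : ℕ := ⌊iterLog 2 M ^ γ⌋₊

variable (K : Type*) [Field K] [NumberField K]

variable {K} in
/-- The rational prime `p` below a nonzero prime ideal `𝔭` (the positive generator of `𝔭 ∩ ℤ`). -/
def primeBelow (𝔭 : Ideal (𝓞 K)) : ℕ := Ideal.absNorm (Ideal.under ℤ 𝔭)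

/-- The set `ℙ_k` of prime ideals above primes in
`(e ^ k log M log₂ M, e ^ (k + 1) log M log₂ M]`. -/
def shellPrimes (M k : ℕ) : Set (Ideal (𝓞 K)) :=
  {𝔭 | 𝔭.IsPrime ∧ 𝔭 ≠ ⊥ ∧
    Real.exp k * (iterLog 1 M * iterLog 2 M) < primeBelow 𝔭 ∧
    primeBelow 𝔭 ≤ Real.exp (k + 1) * (iterLog 1 M * iterLog 2 M)}

/-- The set `ℙ`, the union of the `ℙ_k` over `k = 1, …, ⌊(log₂ M) ^ γ⌋ - 1`. -/
def resonatorPrimes (γ : ℝ) (M : ℕ) : Set (Ideal (𝓞 K)) :=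
  ⋃ k ∈ Finset.Icc 1 (shellCount γ M - 1), shellPrimes K M k

/-- The squarefree ideals generated by the prime ideals in `ℙ`. -/
def supportIdeals (γ : ℝ) (M : ℕ) : Set (Ideal (𝓞 K)) :=
  {𝔫 | Squarefree 𝔫 ∧ ∀ 𝔭 ∈ UniqueFactorizationMonoid.primeFactors 𝔫, 𝔭 ∈ resonatorPrimes K γ M}

variable {K} in
/-- The factor `1 / (√p (log p - log₂ M - log₃ M))` attached to a prime ideal `𝔭` above `p`. -/
def primeWeight (M : ℕ) (𝔭 : Ideal (𝓞 K)) : ℝ :=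
  1 / (√(primeBelow 𝔭 : ℝ) * (Real.log (primeBelow 𝔭) - iterLog 2 M - iterLog 3 M))

/-- The factor `√(log M log₂ M / log₃ M)`. -/
def amplitude (M : ℕ) : ℝ := √(iterLog 1 M * iterLog 2 M / iterLog 3 M)

open scoped Classical in
variable {K} in
/-- The multiplicative function `f` supported on the squarefree ideals generated by `ℙ`, with
`f(𝔭) = √(log M log₂ M / log₃ M) / (√p (log p - log₂ M - log₃ M))` for `𝔭 ∈ ℙ`. -/
def resonator (γ : ℝ) (M : ℕ) (𝔫 : Ideal (𝓞 K)) : ℝ :=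
  if 𝔫 ∈ supportIdeals K γ M then
    ∏ 𝔭 ∈ UniqueFactorizationMonoid.primeFactors 𝔫, amplitude M * primeWeight M 𝔭
  else 0

open scoped Classical in
/-- The set `𝓜`: ideals in the support of `f` that have, for each
`k = 1, …, ⌊(log₂ M) ^ γ⌋ - 1`, fewer than `a log M / (k² log₃ M)` prime factors in `ℙ_k`. -/
def resonatorSet (γ a : ℝ) (M : ℕ) : Set (Ideal (𝓞 K)) :=
  {𝔫 ∈ supportIdeals K γ M | ∀ k ∈ Finset.Icc 1 (shellCount γ M - 1),
    (((UniqueFactorizationMonoid.primeFactors 𝔫).filter (· ∈ shellPrimes K M k)).card : ℝ) <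
      a * iterLog 1 M / ((k : ℝ) ^ 2 * iterLog 3 M)}

variable {K} in
/-- The norm `N(𝔫/𝔪) = N𝔫 / N𝔪` (for `𝔪 ∣ 𝔫`). -/
def normQuot (𝔫 𝔪 : Ideal (𝓞 K)) : ℝ := (Ideal.absNorm 𝔫 : ℝ) / Ideal.absNorm 𝔪

/-- The pairs `(𝔪, 𝔫)` in `𝓜 × 𝓜` with `𝔪 ∣ 𝔫` and `N(𝔫/𝔪) < √D`. -/
def resonancePairs (γ a : ℝ) (M D : ℕ) : Set (Ideal (𝓞 K) × Ideal (𝓞 K)) :=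
  {x | x.1 ∈ resonatorSet K γ a M ∧ x.2 ∈ resonatorSet K γ a M ∧ x.1 ∣ x.2 ∧
    normQuot x.2 x.1 < √(D : ℝ)}

/-- The resonance ratio
`(∑_{𝔪 ∈ 𝓜} f(𝔪)²)⁻¹ ∑_{𝔪, 𝔫 ∈ 𝓜, 𝔪 ∣ 𝔫, N(𝔫/𝔪) < √D} f(𝔪) f(𝔫) / √N(𝔫/𝔪)`. -/
def resonanceRatio (γ a : ℝ) (M D : ℕ) : ℝ :=
  1 / (∑ᶠ 𝔪 ∈ resonatorSet K γ a M, resonator γ M 𝔪 ^ 2) *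
    ∑ᶠ x ∈ resonancePairs K γ a M D,
      resonator γ M x.1 * resonator γ M x.2 / √(normQuot x.2 x.1)

/-- The sum `∑_{𝔭 ∈ ℙ} 1 / (√N𝔭 √p (log p - log₂ M - log₃ M))`; it is finite by
`resonatorPrimes_finite`. -/
def primeSum (γ : ℝ) (M : ℕ) : ℝ :=
  ∑ᶠ 𝔭 ∈ resonatorPrimes K γ M, 1 / √(Ideal.absNorm 𝔭 : ℝ) * primeWeight M 𝔭

/-- There are finitely many prime ideals above primes in a bounded interval. -/
theorem shellPrimes_finite (M k : ℕ) : (shellPrimes K M k).Finite := by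
  have key : ∀ p : ℕ, {𝔭 : Ideal (𝓞 K) | 𝔭.IsPrime ∧ 𝔭 ≠ ⊥ ∧ primeBelow 𝔭 = p}.Finite := by
    intro p
    rcases Nat.eq_zero_or_pos p with rfl | hp
    · convert Set.finite_empty
      ext 𝔭
      simp only [Set.mem_ofPred_eq, Set.mem_empty_iff_false, iff_false]
      rintro ⟨h1, h2, h3⟩
      have : NeZero 𝔭 := ⟨h2⟩
      exact (Nat.absNorm_under_prime 𝔭).ne_zero h3
    · have hb : Ideal.span {((p : ℕ) : 𝓞 K)} ≠ ⊥ := by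
        simp [hp.ne']
      refine (Ideal.finite_factors hb |>.image fun v => v.asIdeal).subset ?_
      rintro 𝔭 ⟨h1, h2, h3⟩
      refine ⟨⟨𝔭, h1, h2⟩, ?_, rfl⟩
      simp only [Set.mem_ofPred_eq]
      rw [Ideal.dvd_span_singleton, ← h3]
      exact Int.absNorm_under_mem 𝔭
  refine ((Set.finite_Iic ⌊Real.exp (k + 1) * (iterLog 1 M * iterLog 2 M)⌋₊).biUnion
    fun p _ => key p).subset ?_
  rintro 𝔭 ⟨h1, h2, -, h4⟩
  simp only [Set.mem_iUnion, Set.mem_ofPred_eq, exists_prop]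
  exact ⟨primeBelow 𝔭, Nat.le_floor h4, h1, h2, rfl⟩

/-- The set `ℙ` is finite. -/
theorem resonatorPrimes_finite (γ : ℝ) (M : ℕ) : (resonatorPrimes K γ M).Finite :=
  (Finset.finite_toSet _).biUnion fun k _ => shellPrimes_finite K M k

end Resonance

end

/-
Attach to a set `S` of primes of `ℙ` the squarefree ideal `∏ S`. Over all pairs `R ⊆ S` of subsets
of `ℙ` the sum of `f(∏ R) f(∏ S) / √N(∏ S / ∏ R)` is the product of `1 + f(𝔭)² + f(𝔭) / √N𝔭`, and
the sum of `f(∏ S)²` is that of `1 + f(𝔭)²`. Since `f(𝔭)² + f(𝔭) / √N𝔭` is `O(1 / log₃ M)`, their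
quotient is at least the exponential of `(1 + o(1)) ∑ f(𝔭) / √N𝔭`. Rankin's trick shows that the
pairs with too many prime factors in some `ℙ_k` are negligible, as are those with
`N(∏ S / ∏ R) ≥ √D`: the former are weighted by `(a / d) ^ (#(S ∩ ℙ_k) - a log M / (k² log₃ M))`,
where `d` bounds the degree of the field, the latter by `(N(∏ S / ∏ R) / √D) ^ (1 / log₂ M)`. The
first step is the reason for `a > d`, and it needs the sharp bound `(1 + o(1)) d / log₂ M` for the
sum of `1 / p` over `ℙ_k`. That bound follows from the continuity of `ζ'/ζ + 1/(s - 1)` on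
`Re s ≥ 1`, upon testing against Fejér kernels, which are positive both in time and in frequency.
Finally `|𝓜|` is bounded by Rankin's trick with the weights `e^{-k} / (k² log₃ M)` on `ℙ_k`.
-/

noncomputable section

namespace Resonance

section FejerKernel

open MeasureTheory

/-- The triangle weight `1 - |t| / T`, to be used on `[-T, T]` only. -/
def fejerWeight (T t : ℝ) : ℝ := 1 - |t| / T

@[fun_prop]
theorem continuous_fejerWeight (T : ℝ) : Continuous (fejerWeight T) := by
  unfold fejerWeight
  fun_prop

theorem fejerWeight_nonneg {T t : ℝ} (hT : 0 < T) (ht : |t| ≤ T) : 0 ≤ fejerWeight T t :=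
  sub_nonneg.2 ((div_le_one hT).2 ht)

theorem fejerWeight_le_one {T : ℝ} (hT : 0 ≤ T) (t : ℝ) : fejerWeight T t ≤ 1 :=
  sub_le_self _ (by positivity)

/-- The Fejér kernel in the frequency variable: the Fourier transform of the triangle weight,
without normalization. -/
def fejerKernel (T v : ℝ) : ℝ := ∫ t in -T..T, fejerWeight T t * Real.cos (t * v)

@[fun_prop]
theorem continuous_fejerKernel (T : ℝ) : Continuous (fejerKernel T) := by
  unfold fejerKernel
  exact intervalIntegral.continuous_parametric_intervalIntegral_of_continuous' (by fun_prop) _ _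

theorem integral_zero_right_fejerWeight_mul_cos {T v : ℝ} (hT : 0 < T) (hv : v ≠ 0) :
    ∫ t in 0..T, fejerWeight T t * Real.cos (t * v) = (1 - Real.cos (T * v)) / (T * v ^ 2) := by
  have habs : ∫ t in 0..T, fejerWeight T t * Real.cos (t * v) =
      ∫ t in 0..T, (1 - t / T) * Real.cos (t * v) := by
    refine intervalIntegral.integral_congr fun t ht => ?_
    rw [Set.uIcc_of_le hT.le] at ht
    simp only [fejerWeight, abs_of_nonneg ht.1]
  rw [habs, intervalIntegral.integral_eq_sub_of_hasDerivAt
    (f := fun t => (1 - t / T) * Real.sin (t * v) / v - Real.cos (t * v) / (T * v ^ 2))]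
  · field_simp
    simp only [sub_self, mul_zero, zero_mul, zero_sub, sub_zero, Real.sin_zero, Real.cos_zero,
      sub_neg_eq_add]
    ring
  · intro t _
    have hs : HasDerivAt (fun t : ℝ => Real.sin (t * v)) (Real.cos (t * v) * v) t := by
      simpa using ((hasDerivAt_id t).mul_const v).sin
    have hc : HasDerivAt (fun t : ℝ => Real.cos (t * v)) (-Real.sin (t * v) * v) t := by
      simpa using ((hasDerivAt_id t).mul_const v).cos
    have hl : HasDerivAt (fun t : ℝ => 1 - t / T) (-(1 / T)) t := by
      simpa using ((hasDerivAt_id t).div_const T).const_sub 1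
    refine (((hl.mul hs).div_const v).sub (hc.div_const (T * v ^ 2))).congr_deriv ?_
    field_simp
    ring
  · exact Continuous.intervalIntegrable (by fun_prop) _ _

theorem fejerKernel_eq {T v : ℝ} (hT : 0 < T) (hv : v ≠ 0) :
    fejerKernel T v = 2 * (1 - Real.cos (T * v)) / (T * v ^ 2) := by
  have hcont : Continuous fun t : ℝ => fejerWeight T t * Real.cos (t * v) := by fun_prop
  have heven := intervalIntegral.integral_comp_neg
    (f := fun t : ℝ => fejerWeight T t * Real.cos (t * v)) (a := 0) (b := T)
  simp only [fejerWeight, abs_neg, neg_mul, Real.cos_neg, neg_zero] at heven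
  rw [fejerKernel, ← intervalIntegral.integral_add_adjacent_intervals
    (hcont.intervalIntegrable _ 0) (hcont.intervalIntegrable 0 _)]
  simp only [fejerWeight]
  rw [← heven]
  have := integral_zero_right_fejerWeight_mul_cos hT hv
  simp only [fejerWeight] at this
  rw [this]
  ring

theorem fejerKernel_zero_pos {T : ℝ} (hT : 0 < T) : 0 < fejerKernel T 0 := by
  refine intervalIntegral.integral_pos (by linarith) (by fun_prop) (fun t ht => ?_)
    ⟨0, ⟨by linarith, hT.le⟩, by simp [fejerWeight]⟩
  simpa using fejerWeight_nonneg hT (abs_le.2 ⟨ht.1.le, ht.2⟩)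

theorem fejerKernel_nonneg {T : ℝ} (hT : 0 < T) (v : ℝ) : 0 ≤ fejerKernel T v := by
  rcases eq_or_ne v 0 with rfl | hv
  · exact (fejerKernel_zero_pos hT).le
  · rw [fejerKernel_eq hT hv]
    have : 0 ≤ 1 - Real.cos (T * v) := sub_nonneg.2 (Real.cos_le_one _)
    positivity

theorem fejerKernel_scale {T : ℝ} (hT : 0 < T) (v : ℝ) :
    fejerKernel T v = T * fejerKernel 1 (T * v) := by
  have hsubst := intervalIntegral.integral_comp_mul_left
      (f := fun t : ℝ => fejerWeight T t * Real.cos (t * v)) (a := -1) (b := 1) hT.ne'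
  simp only [mul_neg, mul_one, smul_eq_mul] at hsubst
  rw [fejerKernel, fejerKernel, eq_comm, ← mul_inv_cancel_left₀ hT.ne' (∫ t in -T..T, _),
    ← hsubst]
  congr 1
  refine intervalIntegral.integral_congr fun t _ => ?_
  simp only [fejerWeight, abs_mul, abs_of_pos hT, div_one, mul_div_cancel_left₀ _ hT.ne']
  ring_nf

theorem fejerKernel_le {T : ℝ} (hT : 0 < T) (v : ℝ) : fejerKernel T v ≤ 2 * T := by
  have : fejerKernel T v ≤ ∫ _ in -T..T, (1 : ℝ) := by
    refine intervalIntegral.integral_mono_on (by linarith)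
      (Continuous.intervalIntegrable (by fun_prop) _ _) (by simp) fun _ ht => ?_
    exact (mul_le_of_le_one_right (fejerWeight_nonneg hT (abs_le.2 ht))
      (Real.cos_le_one _)).trans (fejerWeight_le_one hT.le _)
  refine this.trans_eq ?_
  rw [intervalIntegral.integral_const, smul_eq_mul]
  ring

theorem integrable_mul_fejerKernel {X : Type*} [MeasurableSpace X] {μ : Measure X} {T : ℝ}
    (hT : 0 < T) {g φ : X → ℝ} (hg : Integrable g μ) (hφ : Measurable φ) (U : ℝ) :
    Integrable (fun x => g x * fejerKernel T (φ x - U)) μ := by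
  refine hg.mul_bdd (c := 2 * T) ?_ (ae_of_all _ fun x => ?_)
  · exact ((continuous_fejerKernel T).measurable.comp (hφ.sub_const U)).aestronglyMeasurable
  · rw [Real.norm_of_nonneg (fejerKernel_nonneg hT _)]
    exact fejerKernel_le hT _

theorem fejerKernel_one_le (v : ℝ) : fejerKernel 1 v ≤ 8 * (1 + v ^ 2)⁻¹ := by
  have hle := fejerKernel_le one_pos v
  have hpos : (0 : ℝ) < 1 + v ^ 2 := by positivity
  rw [← div_eq_mul_inv, le_div_iff₀ hpos]
  rcases eq_or_ne v 0 with rfl | hv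
  · nlinarith
  · have htail : fejerKernel 1 v * v ^ 2 ≤ 4 := by
      rw [fejerKernel_eq one_pos hv, one_mul, one_mul, div_mul_cancel₀ _ (by positivity)]
      linarith [Real.neg_one_le_cos v]
    nlinarith

theorem integrable_fejerKernel_one : Integrable (fejerKernel 1) := by
  refine (integrable_inv_one_add_sq.const_mul 8).mono'
    (continuous_fejerKernel 1).aestronglyMeasurable (ae_of_all _ fun v => ?_)
  rw [Real.norm_of_nonneg (fejerKernel_nonneg one_pos v)]
  exact fejerKernel_one_le v

theorem integrable_fejerKernel {T : ℝ} (hT : 0 < T) : Integrable (fejerKernel T) := by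
  rw [funext (fejerKernel_scale hT)]
  exact (integrable_fejerKernel_one.comp_mul_left' hT.ne').const_mul T

theorem integral_fejerKernel {T : ℝ} (hT : 0 < T) :
    ∫ v, fejerKernel T v = ∫ v, fejerKernel 1 v := by
  simp_rw [fejerKernel_scale hT]
  rw [integral_const_mul, Measure.integral_comp_mul_left (fejerKernel 1) T, smul_eq_mul,
    abs_of_pos (inv_pos.2 hT), mul_inv_cancel_left₀ hT.ne']

theorem integral_fejerKernel_one_pos : 0 < ∫ v, fejerKernel 1 v := by
  rw [integral_pos_iff_support_of_nonneg (fejerKernel_nonneg one_pos) integrable_fejerKernel_one]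
  exact (continuous_fejerKernel 1).isOpen_support.measure_pos _
    ⟨0, (fejerKernel_zero_pos one_pos).ne'⟩

theorem tendsto_integral_fejerKernel {η : ℝ} (hη : 0 < η) :
    Tendsto (fun T : ℝ => ∫ v in -η..η, fejerKernel T v) atTop (𝓝 (∫ v, fejerKernel 1 v)) := by
  have hlim : Tendsto (fun T : ℝ => ∫ v in -(T * η)..(T * η), fejerKernel 1 v) atTop
      (𝓝 (∫ v, fejerKernel 1 v)) :=
    intervalIntegral_tendsto_integral integrable_fejerKernel_one
      (tendsto_neg_atTop_atBot.comp (tendsto_id.atTop_mul_const hη))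
      (tendsto_id.atTop_mul_const hη)
  refine hlim.congr' ?_
  filter_upwards [eventually_gt_atTop 0] with T hT
  simp_rw [fejerKernel_scale hT]
  rw [intervalIntegral.integral_const_mul, intervalIntegral.integral_comp_mul_left _ hT.ne',
    smul_eq_mul, mul_inv_cancel_left₀ hT.ne', mul_neg]

end FejerKernel

section FejerTransform

open MeasureTheory

open Complex (I)

/-- The Fourier transform of `G` at frequency `U`, smoothed by the triangle weight on `[-T, T]`. -/
def fejerTransform (T : ℝ) (G : ℝ → ℂ) (U : ℝ) : ℂ :=
  ∫ t in -T..T, (fejerWeight T t : ℂ) * Complex.exp ((t * U : ℝ) * I) * G t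

theorem fejerTransform_add {T U : ℝ} {G H : ℝ → ℂ} (hG : Continuous G) (hH : Continuous H) :
    fejerTransform T (G + H) U = fejerTransform T G U + fejerTransform T H U := by
  rw [fejerTransform, fejerTransform, fejerTransform, ← intervalIntegral.integral_add
    (Continuous.intervalIntegrable (by fun_prop) _ _)
    (Continuous.intervalIntegrable (by fun_prop) _ _)]
  simp_rw [Pi.add_apply, mul_add]

theorem fejerTransform_const_mul (T U : ℝ) (c : ℂ) (G : ℝ → ℂ) :
    fejerTransform T (fun t => c * G t) U = c * fejerTransform T G U := by
  rw [fejerTransform, fejerTransform, ← intervalIntegral.integral_const_mul]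
  simp_rw [mul_left_comm]

theorem continuous_fejerTransform {G : ℝ → ℝ → ℂ} (hG : Continuous fun x : ℝ × ℝ => G x.1 x.2)
    (T U : ℝ) : Continuous fun σ => fejerTransform T (G σ) U :=
  intervalIntegral.continuous_parametric_intervalIntegral_of_continuous'
    (f := fun σ t => (fejerWeight T t : ℂ) * Complex.exp ((t * U : ℝ) * I) * G σ t)
    (Continuous.mul (by fun_prop) hG) _ _

theorem tendsto_fejerTransform_atTop {T : ℝ} (hT : 0 < T) (G : ℝ → ℂ) :
    Tendsto (fejerTransform T G) atTop (𝓝 0) := by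
  have hfreq : Tendsto (fun U : ℝ => -(U / (2 * Real.pi))) atTop (cocompact ℝ) :=
    (tendsto_neg_atTop_atBot.comp (tendsto_id.atTop_div_const (by positivity))).mono_right
      atBot_le_cocompact
  refine ((Real.tendsto_integral_exp_smul_cocompact
    ((Set.Ioc (-T) T).indicator fun t => (fejerWeight T t : ℂ) * G t)).comp hfreq).congr fun U => ?_
  rw [fejerTransform, intervalIntegral.integral_of_le (by linarith),
    ← integral_indicator measurableSet_Ioc]
  refine integral_congr_ae (ae_of_all _ fun t => ?_)
  have hphase : 2 * Real.pi * -(t * -(U / (2 * Real.pi))) = t * U := by field_simp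
  by_cases ht : t ∈ Set.Ioc (-T) T
  · simp only [Set.indicator_of_mem ht, Circle.smul_def, Real.fourierChar_apply, smul_eq_mul,
      hphase]
    ring
  · simp only [Set.indicator_of_notMem ht, smul_zero]

theorem re_fejerTransform_integral {X : Type*} [MeasurableSpace X] {μ : Measure X} [SFinite μ]
    {T : ℝ} (hT : 0 < T) {g φ : X → ℝ} (hg : Integrable g μ) (hφ : Measurable φ) (U : ℝ) :
    (fejerTransform T (fun t => ∫ x, (g x : ℂ) * Complex.exp ((-(t * φ x) : ℝ) * I) ∂μ) U).re =
      ∫ x, g x * fejerKernel T (φ x - U) ∂μ := by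
  set ν := (volume.restrict (Set.Ioc (-T) T)).prod μ
  set H : ℝ × X → ℂ := fun z => (fejerWeight T z.1 : ℂ) * Complex.exp ((z.1 * U : ℝ) * I) *
    ((g z.2 : ℂ) * Complex.exp ((-(z.1 * φ z.2) : ℝ) * I)) with hH
  have hHint : Integrable H ν := by
    have hgν : Integrable (fun z : ℝ × X => (g z.2 : ℂ)) ν := (hg.comp_snd _).ofReal
    have hgH : Integrable (fun z => (g z.2 : ℂ) * Complex.exp ((-(z.1 * φ z.2) : ℝ) * I)) ν :=
      hgν.mul_bdd (c := 1) (by fun_prop)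
        (ae_of_all _ fun z => (Complex.norm_exp_ofReal_mul_I _).le)
    refine hgH.bdd_mul (c := 1) (by fun_prop) ?_
    filter_upwards [Measure.quasiMeasurePreserving_fst.ae (ae_restrict_mem measurableSet_Ioc)]
      with z hz
    rw [norm_mul, Complex.norm_exp_ofReal_mul_I, mul_one, Complex.norm_real,
      Real.norm_of_nonneg (fejerWeight_nonneg hT (abs_le.2 ⟨hz.1.le, hz.2⟩))]
    exact fejerWeight_le_one hT.le _
  have hHre : ∀ z, (H z).re = g z.2 * (fejerWeight T z.1 * Real.cos (z.1 * (φ z.2 - U))) := by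
    intro z
    have hphase : H z = ((g z.2 * fejerWeight T z.1 : ℝ) : ℂ) *
        Complex.exp ((-(z.1 * (φ z.2 - U)) : ℝ) * I) := by
      rw [hH, show -(z.1 * (φ z.2 - U)) = z.1 * U + -(z.1 * φ z.2) by ring, Complex.ofReal_add,
        add_mul, Complex.exp_add]
      push_cast
      ring
    rw [hphase, Complex.re_ofReal_mul, Complex.exp_ofReal_mul_I_re, Real.cos_neg, mul_assoc]
  have hre : (∫ z, H z ∂ν).re = ∫ z, (H z).re ∂ν := (integral_re hHint).symm
  have hT' : -T ≤ T := by linarith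
  calc (fejerTransform T (fun t => ∫ x, (g x : ℂ) * Complex.exp ((-(t * φ x) : ℝ) * I) ∂μ) U).re
      = (∫ z, H z ∂ν).re := by
        rw [integral_prod _ hHint, fejerTransform, intervalIntegral.integral_of_le hT']
        simp_rw [hH, integral_const_mul]
    _ = ∫ x, g x * fejerKernel T (φ x - U) ∂μ := by
        rw [hre]
        simp_rw [hHre]
        rw [integral_prod_symm _ (hHint.re.congr (ae_of_all _ hHre))]
        simp_rw [integral_const_mul, fejerKernel, intervalIntegral.integral_of_le hT']

end FejerTransform

section Tauberian

open MeasureTheory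

open Complex (I)

variable {f : ℕ → ℝ} {A : ℝ} {F : ℂ → ℂ}

theorem term_one_add_eq (f : ℕ → ℝ) {σ : ℝ} (hσ : 0 < σ) (t : ℝ) (n : ℕ) :
    LSeries.term (fun n => (f n : ℂ)) (1 + σ + t * I) n =
      (f n * (n : ℝ) ^ (-(1 + σ)) : ℝ) * Complex.exp ((-(t * Real.log n) : ℝ) * I) := by
  rcases eq_or_ne n 0 with rfl | hn
  · simp [Real.zero_rpow (by linarith : -σ + -1 ≠ 0)]
  have hpos : (0 : ℝ) < n := by exact_mod_cast hn.bot_lt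
  rw [LSeries.term_of_ne_zero hn, div_eq_mul_inv, ← Complex.cpow_neg,
    Complex.cpow_def_of_ne_zero (by exact_mod_cast hn), Complex.ofReal_mul,
    Real.rpow_def_of_pos hpos, Complex.ofReal_exp, mul_assoc, ← Complex.exp_add,
    ← Complex.ofReal_natCast, ← Complex.ofReal_log hpos.le]
  push_cast
  ring_nf

theorem sum_fejerKernel_le_re_fejerTransform_LSeries (hf : ∀ n, 0 ≤ f n) {T σ : ℝ} (hT : 0 < T)
    (hσ : 0 < σ) (hs : LSeriesSummable (fun n => (f n : ℂ)) (1 + σ)) (U : ℝ) (s : Finset ℕ) :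
    ∑ n ∈ s, f n * (n : ℝ) ^ (-(1 + σ)) * fejerKernel T (Real.log n - U) ≤
      (fejerTransform T (fun t => LSeries (fun n => (f n : ℂ)) (1 + σ + t * I)) U).re := by
  set g : ℕ → ℝ := fun n => f n * (n : ℝ) ^ (-(1 + σ))
  have hterm (t : ℝ) (n : ℕ) := term_one_add_eq f hσ t n
  have hg : Integrable g Measure.count := by
    refine integrable_count_iff.2 (hs.norm.congr fun n => ?_)
    simpa [g] using congrArg norm (hterm 0 n)
  have hkernel := integrable_mul_fejerKernel hT hg (φ := fun n : ℕ => Real.log n) (by fun_prop) U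
  have hseries (t : ℝ) : LSeries (fun n => (f n : ℂ)) (1 + σ + t * I) =
      ∫ n, (g n : ℂ) * Complex.exp ((-(t * Real.log n) : ℝ) * I) ∂Measure.count := by
    rw [integral_countable, LSeries]
    · simp only [hterm, Measure.real, Measure.count_singleton, ENNReal.toReal_one, one_smul, g]
    · exact hg.ofReal.mul_bdd (c := 1) (measurable_from_nat.aestronglyMeasurable)
        (ae_of_all _ fun n => (Complex.norm_exp_ofReal_mul_I _).le)
  simp_rw [hseries]
  rw [re_fejerTransform_integral hT hg (by fun_prop), integral_countable hkernel]
  simp only [Measure.real, Measure.count_singleton, ENNReal.toReal_one, one_smul]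
  exact (integrable_count_iff.1 hkernel).of_norm.sum_le_tsum s fun n _ =>
    mul_nonneg (mul_nonneg (hf n) (by positivity)) (fejerKernel_nonneg hT _)

theorem re_fejerTransform_pole_le {T σ : ℝ} (hT : 0 < T) (hσ : 0 < σ) (U : ℝ) :
    (fejerTransform T (fun t => 1 / (σ + t * I)) U).re ≤ ∫ v, fejerKernel 1 v := by
  have hpole (t : ℝ) : 1 / ((σ : ℂ) + t * I) = ∫ v in Set.Ioi (0 : ℝ),
      (Real.exp (-σ * v) : ℂ) * Complex.exp ((-(t * v) : ℝ) * I) := by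
    have hlaplace := integral_exp_mul_complex_Ioi (a := -(σ + t * I)) (by simpa using hσ) 0
    rw [Complex.ofReal_zero, mul_zero, Complex.exp_zero, div_neg, neg_div, neg_neg] at hlaplace
    rw [← hlaplace]
    refine integral_congr_ae (ae_of_all _ fun v => ?_)
    simp only [Complex.ofReal_exp, ← Complex.exp_add]
    congr 1
    push_cast
    ring
  have hexp : IntegrableOn (fun v => Real.exp (-σ * v)) (Set.Ioi 0) :=
    exp_neg_integrableOn_Ioi 0 hσ
  have hK : Integrable fun v => fejerKernel T (v - U) :=
    (integrable_fejerKernel hT).comp_sub_right U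
  simp_rw [hpole]
  refine (re_fejerTransform_integral (φ := id) hT hexp measurable_id U).trans_le ?_
  calc ∫ v in Set.Ioi (0 : ℝ), Real.exp (-σ * v) * fejerKernel T (v - U)
      ≤ ∫ v in Set.Ioi (0 : ℝ), fejerKernel T (v - U) := by
        exact setIntegral_mono_on (integrable_mul_fejerKernel hT hexp measurable_id U)
          hK.integrableOn measurableSet_Ioi fun v hv =>
            mul_le_of_le_one_left (fejerKernel_nonneg hT _)
              (Real.exp_le_one_iff.2 (by nlinarith [Set.mem_Ioi.1 hv]))
    _ ≤ ∫ v, fejerKernel T (v - U) :=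
        setIntegral_le_integral hK (ae_of_all _ fun v => fejerKernel_nonneg hT _)
    _ = ∫ v, fejerKernel 1 v := by
        rw [integral_sub_right_eq_self, integral_fejerKernel hT]

theorem sum_rpow_mul_fejerKernel_le (hf : ∀ n, 0 ≤ f n) (hA : 0 ≤ A) {T σ : ℝ} (hT : 0 < T)
    (hσ : 0 < σ) (hs : LSeriesSummable (fun n => (f n : ℂ)) (1 + σ))
    (hF : ContinuousOn F {s | 1 ≤ s.re})
    (hFf : Set.EqOn F (fun s => LSeries (fun n => (f n : ℂ)) s - A / (s - 1)) {s | 1 < s.re})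
    (U : ℝ) (s : Finset ℕ) :
    ∑ n ∈ s, f n * (n : ℝ) ^ (-(1 + σ)) * fejerKernel T (Real.log n - U) ≤
      (fejerTransform T (fun t => F (1 + σ + t * I)) U).re + A * ∫ v, fejerKernel 1 v := by
  refine (sum_fejerKernel_le_re_fejerTransform_LSeries hf hT hσ hs U s).trans ?_
  have hsplit : (fun t : ℝ => LSeries (fun n => (f n : ℂ)) (1 + σ + t * I)) =
      (fun t : ℝ => F (1 + σ + t * I)) + fun t : ℝ => (A : ℂ) * (1 / (σ + t * I)) := by
    funext t
    have hre : (1 + σ + t * I : ℂ) ∈ {s : ℂ | 1 < s.re} := by simpa using hσ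
    have hsub : (1 + σ + t * I : ℂ) - 1 = σ + t * I := by ring
    simp only [Pi.add_apply, hFf hre, hsub, mul_one_div, sub_add_cancel]
  have hFcont : Continuous fun t : ℝ => F (1 + σ + t * I) :=
    hF.comp_continuous (by fun_prop) fun t => by simpa using hσ.le
  have hne (t : ℝ) : (σ + t * I : ℂ) ≠ 0 := fun h => hσ.ne' (by simpa using congrArg Complex.re h)
  have hpole : Continuous fun t : ℝ => (A : ℂ) * (1 / (σ + t * I)) :=
    continuous_const.mul (continuous_const.div (by fun_prop) hne)
  rw [hsplit, fejerTransform_add hFcont hpole, fejerTransform_const_mul, Complex.add_re,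
    Complex.re_ofReal_mul]
  gcongr
  exact re_fejerTransform_pole_le hT hσ U

theorem tendsto_natCast_rpow_neg_one_add (n : ℕ) :
    Tendsto (fun σ : ℝ => (n : ℝ) ^ (-(1 + σ))) (𝓝[>] 0) (𝓝 (n : ℝ)⁻¹) := by
  rcases eq_or_ne n 0 with rfl | hn
  · refine tendsto_const_nhds.congr' ?_
    filter_upwards [self_mem_nhdsWithin] with σ (hσ : 0 < σ)
    simp [Real.zero_rpow (by linarith : -σ + -1 ≠ 0)]
  · have hcont : Continuous fun σ : ℝ => (n : ℝ) ^ (-(1 + σ)) :=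
      Continuous.rpow continuous_const (by fun_prop) fun _ => Or.inl (by exact_mod_cast hn)
    simpa [Real.rpow_neg_one] using (hcont.tendsto 0).mono_left nhdsWithin_le_nhds

theorem sum_div_mul_fejerKernel_le (hf : ∀ n, 0 ≤ f n) (hA : 0 ≤ A)
    (hs : ∀ σ : ℝ, 0 < σ → LSeriesSummable (fun n => (f n : ℂ)) (1 + σ))
    (hF : ContinuousOn F {s | 1 ≤ s.re})
    (hFf : Set.EqOn F (fun s => LSeries (fun n => (f n : ℂ)) s - A / (s - 1)) {s | 1 < s.re})
    {T : ℝ} (hT : 0 < T) (U : ℝ) (s : Finset ℕ) :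
    ∑ n ∈ s, f n / n * fejerKernel T (Real.log n - U) ≤
      (fejerTransform T (fun t => F (1 + t * I)) U).re + A * ∫ v, fejerKernel 1 v := by
  have hcont : Continuous fun x : ℝ × ℝ => F (1 + (max x.1 0 : ℝ) + x.2 * I) :=
    hF.comp_continuous (by fun_prop) fun x => by simp
  have hlim := (Complex.continuous_re.comp (continuous_fejerTransform
    (G := fun σ t => F (1 + (max σ 0 : ℝ) + t * I)) hcont T U)).tendsto 0
  simp only [max_self, Complex.ofReal_zero, add_zero, Function.comp_apply] at hlim
  refine le_of_tendsto_of_tendsto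
    (tendsto_finsetSum s fun n _ => ((tendsto_natCast_rpow_neg_one_add n).const_mul (f n)).mul_const
      (fejerKernel T (Real.log n - U)))
    ((hlim.mono_left nhdsWithin_le_nhds).add_const _) ?_
  filter_upwards [self_mem_nhdsWithin] with σ (hσ : 0 < σ)
  simpa only [Function.comp_apply, max_eq_left hσ.le] using
    sum_rpow_mul_fejerKernel_le hf hA hT hσ (hs σ hσ) hF hFf U s

theorem sum_mul_integral_fejerKernel_le {ι : Type*} {s : Finset ι} {c x : ι → ℝ}
    {T U h η B : ℝ} (hT : 0 < T) (hη : 0 ≤ η) (hh : 0 ≤ h) (hc : ∀ n ∈ s, 0 ≤ c n)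
    (hx : ∀ n ∈ s, U ≤ x n ∧ x n ≤ U + h)
    (hB : ∀ w, U - η ≤ w → ∑ n ∈ s, c n * fejerKernel T (x n - w) ≤ B) :
    (∑ n ∈ s, c n) * ∫ v in -η..η, fejerKernel T v ≤ (h + 2 * η) * B := by
  have hlower : ∀ n ∈ s, ∫ v in -η..η, fejerKernel T v ≤
      ∫ w in (U - η)..(U + h + η), fejerKernel T (x n - w) := by
    intro n hn
    have hshift : ∫ v in -η..η, fejerKernel T v =
        ∫ w in (x n - η)..(x n + η), fejerKernel T (x n - w) := by
      rw [intervalIntegral.integral_comp_sub_left (fejerKernel T)]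
      congr 1 <;> ring
    rw [hshift]
    exact intervalIntegral.integral_mono_interval (by linarith [(hx n hn).1]) (by linarith)
      (by linarith [(hx n hn).2]) (ae_of_all _ fun w => fejerKernel_nonneg hT _)
      (Continuous.intervalIntegrable (by fun_prop) _ _)
  calc (∑ n ∈ s, c n) * ∫ v in -η..η, fejerKernel T v
      ≤ ∑ n ∈ s, c n * ∫ w in (U - η)..(U + h + η), fejerKernel T (x n - w) := by
        rw [Finset.sum_mul]
        exact Finset.sum_le_sum fun n hn => mul_le_mul_of_nonneg_left (hlower n hn) (hc n hn)
    _ = ∫ w in (U - η)..(U + h + η), ∑ n ∈ s, c n * fejerKernel T (x n - w) := by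
        rw [intervalIntegral.integral_finsetSum fun n _ =>
          Continuous.intervalIntegrable (by fun_prop) _ _]
        simp_rw [intervalIntegral.integral_const_mul]
    _ ≤ ∫ _ in (U - η)..(U + h + η), B :=
        intervalIntegral.integral_mono_on (by linarith)
          (Continuous.intervalIntegrable (by fun_prop) _ _) (by simp) fun w hw => hB w hw.1
    _ = (h + 2 * η) * B := by
        rw [intervalIntegral.integral_const, smul_eq_mul]
        ring

theorem eventually_sum_div_le_of_continuousOn (hf : ∀ n, 0 ≤ f n) (hA : 0 ≤ A)
    (hs : ∀ σ : ℝ, 0 < σ → LSeriesSummable (fun n => (f n : ℂ)) (1 + σ))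
    (hF : ContinuousOn F {s | 1 ≤ s.re})
    (hFf : Set.EqOn F (fun s => LSeries (fun n => (f n : ℂ)) s - A / (s - 1)) {s | 1 < s.re})
    {h δ : ℝ} (hh : 0 ≤ h) (hδ : 0 < δ) :
    ∀ᶠ U : ℝ in atTop, ∀ s : Finset ℕ, (∀ n ∈ s, U ≤ Real.log n ∧ Real.log n ≤ U + h) →
      ∑ n ∈ s, f n / n ≤ h * A + δ := by
  set J := ∫ v, fejerKernel 1 v
  have hJpos : 0 < J := integral_fejerKernel_one_pos
  obtain ⟨η, hη, hη0, hη1⟩ : ∃ η : ℝ, (h + 2 * η) * (A + η) < (h * A + δ) * (1 - η) ∧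
      0 < η ∧ η < 1 := by
    have hcont : Continuous fun η : ℝ => (h * A + δ) * (1 - η) - (h + 2 * η) * (A + η) := by
      fun_prop
    have hev : ∀ᶠ η : ℝ in 𝓝[>] 0, 0 < (h * A + δ) * (1 - η) - (h + 2 * η) * (A + η) :=
      ((hcont.tendsto 0).mono_left nhdsWithin_le_nhds).eventually_const_lt (by simpa using hδ)
    obtain ⟨η, hη, hηmem⟩ := (hev.and (Ioo_mem_nhdsGT one_pos)).exists
    exact ⟨η, sub_pos.1 hη, hηmem⟩
  obtain ⟨T, hconc, hT⟩ : ∃ T : ℝ, (1 - η) * J < ∫ v in -η..η, fejerKernel T v ∧ 0 < T :=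
    (((tendsto_integral_fejerKernel hη0).eventually_const_lt (by nlinarith)).and
      (eventually_gt_atTop 0)).exists
  have hRL : Tendsto (fun U => (fejerTransform T (fun t => F (1 + t * I)) U).re) atTop (𝓝 0) :=
    (Complex.continuous_re.tendsto 0).comp (tendsto_fejerTransform_atTop hT _)
  obtain ⟨U₀, hU₀⟩ := eventually_atTop.1 (hRL.eventually_lt_const (mul_pos hη0 hJpos))
  filter_upwards [eventually_ge_atTop (U₀ + η)] with U hU s hsU
  have hc : ∀ n ∈ s, 0 ≤ f n / n := fun n _ => div_nonneg (hf n) n.cast_nonneg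
  have haverage := sum_mul_integral_fejerKernel_le (B := (A + η) * J) hT hη0.le hh hc hsU
    fun w hw => (sum_div_mul_fejerKernel_le hf hA hs hF hFf hT w s).trans (by
      linarith [hU₀ w (by linarith)])
  have hbound : (∑ n ∈ s, f n / n) * ((1 - η) * J) ≤ (h * A + δ) * ((1 - η) * J) :=
    calc (∑ n ∈ s, f n / n) * ((1 - η) * J)
        ≤ (∑ n ∈ s, f n / n) * ∫ v in -η..η, fejerKernel T v :=
          mul_le_mul_of_nonneg_left hconc.le (Finset.sum_nonneg hc)
      _ ≤ (h + 2 * η) * (A + η) * J := by rwa [mul_assoc]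
      _ ≤ (h * A + δ) * (1 - η) * J := mul_le_mul_of_nonneg_right hη.le hJpos.le
      _ = (h * A + δ) * ((1 - η) * J) := mul_assoc _ _ _
  exact le_of_mul_le_mul_right hbound (mul_pos (by linarith) hJpos)

end Tauberian

section PrimeWindows

open ArithmeticFunction hiding log

theorem eventually_sum_vonMangoldt_div_le {h δ : ℝ} (hh : 0 ≤ h) (hδ : 0 < δ) :
    ∀ᶠ U : ℝ in atTop, ∀ s : Finset ℕ, (∀ n ∈ s, U ≤ Real.log n ∧ Real.log n ≤ U + h) →
      ∑ n ∈ s, vonMangoldt n / n ≤ h + δ := by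
  have hresidue : vonMangoldt.residueClass (1 : ZMod 1) = fun n => vonMangoldt n := by
    ext n
    simp [vonMangoldt.residueClass, Set.indicator, eq_iff_true_of_subsingleton]
  have hF := vonMangoldt.eqOn_LFunctionResidueClassAux (a := (1 : ZMod 1)) isUnit_one
  simp only [hresidue, Nat.totient_one, Nat.cast_one, inv_one] at hF
  simpa only [mul_one] using eventually_sum_div_le_of_continuousOn (A := 1)
    (fun n => vonMangoldt_nonneg) zero_le_one
    (fun σ hσ => LSeriesSummable_vonMangoldt (by simpa using hσ))
    (vonMangoldt.continuousOn_LFunctionResidueClassAux (1 : ZMod 1)) (by simpa using hF) hh hδ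

theorem eventually_sum_one_div_prime_le {h δ : ℝ} (hh : 0 ≤ h) (hδ : 0 < δ) :
    ∀ᶠ x : ℝ in atTop, ∀ s : Finset ℕ,
      (∀ p ∈ s, p.Prime ∧ x < p ∧ (p : ℝ) ≤ Real.exp h * x) →
        ∑ p ∈ s, 1 / (p : ℝ) ≤ (h + δ) / Real.log x := by
  filter_upwards [Real.tendsto_log_atTop.eventually (eventually_sum_vonMangoldt_div_le hh hδ),
    eventually_gt_atTop 1] with x hx hx1 s hs
  have hx0 : 0 < x := by linarith
  rw [le_div_iff₀ (Real.log_pos hx1), Finset.sum_mul]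
  refine (Finset.sum_le_sum fun p hp => ?_).trans (hx s fun p hp => ?_)
  · obtain ⟨hprime, hlt, -⟩ := hs p hp
    rw [vonMangoldt_apply_prime hprime, one_div_mul_eq_div]
    gcongr
  · obtain ⟨-, hlt, hle⟩ := hs p hp
    refine ⟨Real.log_le_log hx0 hlt.le, (Real.log_le_log (hx0.trans hlt) hle).trans_eq ?_⟩
    rw [Real.log_mul (Real.exp_pos h).ne' hx0.ne', Real.log_exp, add_comm]

end PrimeWindows

section SquarefreeProducts

open UniqueFactorizationMonoid

variable {R : Type*} [CommMonoidWithZero R] [UniqueFactorizationMonoid R] {S T : Finset R}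

theorem prod_primes_ne_zero [Nontrivial R] (hS : ∀ p ∈ S, Prime p) : ∏ p ∈ S, p ≠ 0 :=
  Finset.prod_ne_zero_iff.2 fun p hp => (hS p hp).ne_zero

variable [Subsingleton Rˣ]

theorem normalizedFactors_prod_primes (hS : ∀ p ∈ S, Prime p) :
    normalizedFactors (∏ p ∈ S, p) = S.val := by
  refine (congrArg _ (Finset.prod_val S)).symm.trans ?_
  exact normalizedFactors_prod_of_prime hS

theorem primeFactors_prod_primes (hS : ∀ p ∈ S, Prime p) : primeFactors (∏ p ∈ S, p) = S := by
  ext p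
  rw [mem_primeFactors, normalizedFactors_prod_primes hS, Finset.mem_val]

variable [Nontrivial R]

theorem squarefree_prod_primes (hS : ∀ p ∈ S, Prime p) : Squarefree (∏ p ∈ S, p) := by
  rw [squarefree_iff_nodup_normalizedFactors (prod_primes_ne_zero hS),
    normalizedFactors_prod_primes hS]
  exact S.nodup

theorem prod_primeFactors_of_squarefree {n : R} (h : Squarefree n) :
    ∏ p ∈ primeFactors n, p = n := by
  refine (Finset.prod_val _).symm.trans ?_
  rw [primeFactors_val_eq_normalizedFactors h.isRadical,
    prod_normalizedFactors_eq h.ne_zero, normalize_eq]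

theorem prod_primes_dvd_prod_primes_iff (hS : ∀ p ∈ S, Prime p) (hT : ∀ p ∈ T, Prime p) :
    ∏ p ∈ S, p ∣ ∏ p ∈ T, p ↔ S ⊆ T := by
  rw [dvd_iff_normalizedFactors_le_normalizedFactors (prod_primes_ne_zero hS)
    (prod_primes_ne_zero hT), normalizedFactors_prod_primes hS,
    normalizedFactors_prod_primes hT, Finset.val_le_iff]

end SquarefreeProducts

section PrimeIdeals

open Module

theorem IsQSqrtNeg.finrank_le_two {D : ℕ} {K : Type*} [Field K] [NumberField K]
    (h : IsQSqrtNeg D K) : finrank ℚ K ≤ 2 := by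
  obtain ⟨x, hx, htop⟩ := h
  have hmonic : (Polynomial.X ^ 2 + Polynomial.C (D : ℚ)).Monic :=
    Polynomial.monic_X_pow_add_C _ two_ne_zero
  have hroot : Polynomial.aeval x (Polynomial.X ^ 2 + Polynomial.C (D : ℚ)) = 0 := by
    simp [hx]
  rw [← IntermediateField.finrank_top', ← htop,
    IntermediateField.adjoin.finrank ⟨_, hmonic, hroot⟩]
  exact (Polynomial.natDegree_le_natDegree (minpoly.min ℚ x hmonic hroot)).trans
    Polynomial.natDegree_X_pow_add_C.le

variable {K : Type*} [Field K] [NumberField K] {𝔭 : Ideal (𝓞 K)}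

theorem primeBelow_prime (h : Prime 𝔭) : (primeBelow 𝔭).Prime := by
  have : NeZero 𝔭 := ⟨h.ne_zero⟩
  have : 𝔭.IsPrime := Ideal.isPrime_of_prime h
  exact Nat.absNorm_under_prime 𝔭

theorem absNorm_pos (h : Prime 𝔭) : 0 < Ideal.absNorm 𝔭 :=
  Nat.pos_of_ne_zero (Ideal.absNorm_eq_zero_iff.not.2 h.ne_zero)

theorem primeBelow_le_absNorm (h : Prime 𝔭) : primeBelow 𝔭 ≤ Ideal.absNorm 𝔭 :=
  Nat.le_of_dvd (absNorm_pos h) (Int.absNorm_under_dvd_absNorm 𝔭)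

theorem dvd_span_primeBelow (𝔭 : Ideal (𝓞 K)) : 𝔭 ∣ Ideal.span {(primeBelow 𝔭 : 𝓞 K)} :=
  Ideal.dvd_span_singleton.2 (Int.absNorm_under_mem 𝔭)

theorem absNorm_dvd_pow_finrank_of_dvd_span {I : Ideal (𝓞 K)} {n : ℕ}
    (h : I ∣ Ideal.span {(n : 𝓞 K)}) : Ideal.absNorm I ∣ n ^ finrank ℚ K := by
  simpa only [Ideal.absNorm_span_natCast, RingOfIntegers.rank] using map_dvd Ideal.absNorm h

theorem absNorm_le_primeBelow_pow_finrank (h : Prime 𝔭) :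
    Ideal.absNorm 𝔭 ≤ primeBelow 𝔭 ^ finrank ℚ K :=
  Nat.le_of_dvd (pow_pos (primeBelow_prime h).pos _)
    (absNorm_dvd_pow_finrank_of_dvd_span (dvd_span_primeBelow 𝔭))

theorem card_primes_over_le_finrank {S : Finset (Ideal (𝓞 K))} (hS : ∀ 𝔭 ∈ S, Prime 𝔭) {p : ℕ}
    (hp : ∀ 𝔭 ∈ S, primeBelow 𝔭 = p) : S.card ≤ finrank ℚ K := by
  rcases S.eq_empty_or_nonempty with rfl | ⟨𝔮, h𝔮⟩
  · simp
  have hprime : p.Prime := hp 𝔮 h𝔮 ▸ primeBelow_prime (hS 𝔮 h𝔮)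
  have hdvd : ∏ 𝔭 ∈ S, 𝔭 ∣ Ideal.span {(p : 𝓞 K)} :=
    Finset.prod_primes_dvd _ hS fun 𝔭 h𝔭 => hp 𝔭 h𝔭 ▸ dvd_span_primeBelow 𝔭
  rw [← Nat.pow_le_pow_iff_right hprime.one_lt]
  calc p ^ S.card ≤ ∏ 𝔭 ∈ S, Ideal.absNorm 𝔭 :=
        Finset.pow_card_le_prod _ _ _ fun 𝔭 h𝔭 => hp 𝔭 h𝔭 ▸ primeBelow_le_absNorm (hS 𝔭 h𝔭)
    _ = Ideal.absNorm (∏ 𝔭 ∈ S, 𝔭) := (map_prod _ _ _).symm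
    _ ≤ p ^ finrank ℚ K :=
        Nat.le_of_dvd (pow_pos hprime.pos _) (absNorm_dvd_pow_finrank_of_dvd_span hdvd)

theorem sum_comp_primeBelow_le {S : Finset (Ideal (𝓞 K))} (hS : ∀ 𝔭 ∈ S, Prime 𝔭)
    {φ : ℕ → ℝ} (hφ : ∀ n, 0 ≤ φ n) :
    ∑ 𝔭 ∈ S, φ (primeBelow 𝔭) ≤ finrank ℚ K * ∑ p ∈ S.image primeBelow, φ p := by
  rw [Finset.sum_comp φ primeBelow, Finset.mul_sum]
  refine Finset.sum_le_sum fun p _ => ?_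
  rw [nsmul_eq_mul]
  refine mul_le_mul_of_nonneg_right (Nat.cast_le.2 ?_) (hφ p)
  exact card_primes_over_le_finrank (fun 𝔭 h𝔭 => hS 𝔭 (Finset.mem_filter.1 h𝔭).1)
    fun 𝔭 h𝔭 => (Finset.mem_filter.1 h𝔭).2

end PrimeIdeals

section RankinTrick

open Finset

variable {ι κ : Type*}

theorem sum_filter_le_sum_mul (s : Finset ι) (q : ι → Prop) [DecidablePred q] {w y : ι → ℝ}
    (hw : ∀ i ∈ s, 0 ≤ w i) (hy : ∀ i ∈ s, 0 ≤ y i) (hq : ∀ i ∈ s, q i → 1 ≤ y i) :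
    ∑ i ∈ s with q i, w i ≤ ∑ i ∈ s, y i * w i := by
  rw [sum_filter]
  refine sum_le_sum fun i hi => ?_
  split_ifs with h
  · exact le_mul_of_one_le_left (hw i hi) (hq i hi h)
  · exact mul_nonneg (hy i hi) (hw i hi)

theorem sum_le_sum_filter_add_sum_sum_filter (s : Finset ι) (J : Finset κ) (bad : κ → ι → Prop)
    [∀ k, DecidablePred (bad k)] [DecidablePred fun i => ∀ k ∈ J, ¬bad k i] {w : ι → ℝ}
    (hw : ∀ i ∈ s, 0 ≤ w i) :
    ∑ i ∈ s, w i ≤ (∑ i ∈ s with ∀ k ∈ J, ¬bad k i, w i) + ∑ k ∈ J, ∑ i ∈ s with bad k i, w i := by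
  simp_rw [sum_filter]
  rw [sum_comm, ← sum_add_distrib]
  refine sum_le_sum fun i hi => ?_
  have hbad : ∀ k ∈ J, 0 ≤ if bad k i then w i else 0 := fun k _ => by
    split_ifs
    exacts [hw i hi, le_rfl]
  split_ifs with h
  · exact le_add_of_nonneg_right (sum_nonneg hbad)
  · push Not at h
    obtain ⟨k, hk, hki⟩ := h
    simpa only [zero_add, if_pos hki] using single_le_sum hbad hk

theorem sum_le_sum_sum_filter (s : Finset ι) (J : Finset κ) (q : κ → ι → Prop)
    [∀ k, DecidablePred (q k)] (hq : ∀ i ∈ s, ∃ k ∈ J, q k i) {w : ι → ℝ} (hw : ∀ i ∈ s, 0 ≤ w i) :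
    ∑ i ∈ s, w i ≤ ∑ k ∈ J, ∑ i ∈ s with q k i, w i := by
  classical
  refine (sum_le_sum_filter_add_sum_sum_filter s J q hw).trans_eq ?_
  rw [filter_false_of_mem fun i hi h => ?_, sum_empty, zero_add]
  obtain ⟨k, hk, hki⟩ := hq i hi
  exact h k hk hki

theorem prod_one_add_add_le (P : Finset ι) {s t : ι → ℝ} (hs : ∀ i ∈ P, 0 ≤ s i)
    (ht : ∀ i ∈ P, 0 ≤ t i) :
    ∏ i ∈ P, (1 + (s i + t i)) ≤ Real.exp (∑ i ∈ P, t i) * ∏ i ∈ P, (1 + s i) := by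
  rw [Real.exp_sum, ← prod_mul_distrib]
  refine prod_le_prod (fun i hi => by linarith [hs i hi, ht i hi]) fun i hi => ?_
  nlinarith [Real.add_one_le_exp (t i), hs i hi, ht i hi]

theorem exp_mul_prod_one_add_le (P : Finset ι) {s t : ι → ℝ} (hs : ∀ i ∈ P, 0 ≤ s i)
    (ht : ∀ i ∈ P, 0 ≤ t i) {ε : ℝ} (hsε : ∀ i ∈ P, s i ≤ ε) (htε : ∀ i ∈ P, t i ≤ ε) :
    Real.exp ((1 - 2 * ε) * ∑ i ∈ P, t i) * ∏ i ∈ P, (1 + s i) ≤ ∏ i ∈ P, (1 + (s i + t i)) := by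
  rw [mul_sum, Real.exp_sum, ← prod_mul_distrib]
  refine prod_le_prod (fun i hi => ?_) fun i hi => ?_
  · exact mul_nonneg (Real.exp_pos _).le (by linarith [hs i hi])
  have hs0 := hs i hi
  have ht0 := ht i hi
  have hpos : 0 < 1 + (s i + t i) := by linarith
  rw [← le_div_iff₀ (by linarith), ← Real.le_log_iff_exp_le (by positivity)]
  calc (1 - 2 * ε) * t i ≤ t i / (1 + (s i + t i)) := by
        have : (1 - 2 * ε) * (1 + (s i + t i)) ≤ 1 := by nlinarith [hsε i hi, htε i hi]
        rw [le_div_iff₀ hpos]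
        nlinarith
    _ = 1 - ((1 + (s i + t i)) / (1 + s i))⁻¹ := by
        field_simp
        ring
    _ ≤ Real.log ((1 + (s i + t i)) / (1 + s i)) :=
        Real.one_sub_inv_le_log_of_pos (by positivity)

theorem prod_ite_one_eq_exp (S : Finset ι) (q : ι → Prop) [DecidablePred q] {z : ℝ} (hz : 0 < z) :
    ∏ i ∈ S, (if q i then z else 1) = Real.exp ((S.filter q).card * Real.log z) := by
  rw [prod_ite, prod_const, prod_const_one, mul_one, Real.exp_nat_mul, Real.exp_log hz]

theorem sum_powerset_filter_card_le (P : Finset ι) (q : ι → Prop) [DecidablePred q] {w : ι → ℝ}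
    (hw : ∀ i ∈ P, 0 ≤ w i) {b : ℝ} (hb : 1 ≤ b) (T : ℝ) :
    ∑ S ∈ P.powerset with T ≤ ((S.filter q).card : ℝ), ∏ i ∈ S, w i ≤
      Real.exp (-(T * Real.log b) + (b - 1) * ∑ i ∈ P with q i, w i) * ∏ i ∈ P, (1 + w i) := by
  have hprod : ∀ S ∈ P.powerset, 0 ≤ ∏ i ∈ S, w i := fun S hS =>
    prod_nonneg fun i hi => hw i (mem_powerset.1 hS hi)
  calc ∑ S ∈ P.powerset with T ≤ ((S.filter q).card : ℝ), ∏ i ∈ S, w i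
      ≤ ∑ S ∈ P.powerset, Real.exp (-(T * Real.log b)) *
          (∏ i ∈ S, if q i then b else 1) * ∏ i ∈ S, w i := by
        refine sum_filter_le_sum_mul _ _ hprod (fun S _ => ?_) fun S _ hS => ?_ <;>
          rw [prod_ite_one_eq_exp S q (by linarith), ← Real.exp_add]
        · exact (Real.exp_pos _).le
        · exact Real.one_le_exp (by nlinarith [Real.log_nonneg hb])
    _ = Real.exp (-(T * Real.log b)) *
          ∏ i ∈ P, (1 + (w i + if q i then (b - 1) * w i else 0)) := by
        simp_rw [mul_assoc, ← mul_sum, ← prod_mul_distrib]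
        rw [← prod_one_add]
        congr! 3
        split_ifs <;> ring
    _ ≤ Real.exp (-(T * Real.log b)) * (Real.exp ((b - 1) * ∑ i ∈ P with q i, w i) *
          ∏ i ∈ P, (1 + w i)) := by
        rw [mul_sum, sum_filter]
        refine mul_le_mul_of_nonneg_left (prod_one_add_add_le P hw fun i hi => ?_)
          (Real.exp_pos _).le
        split_ifs
        exacts [mul_nonneg (by linarith) (hw i hi), le_rfl]
    _ = _ := by rw [← mul_assoc, ← Real.exp_add]

theorem prod_ite_one_le_sum_ite (J : Finset κ) (q : κ → Prop) [DecidablePred q] {z : κ → ℝ}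
    (hz : ∀ k ∈ J, 0 ≤ z k) (hz1 : ∀ k ∈ J, z k ≤ 1) (hq : ∃ k ∈ J, q k) :
    ∏ k ∈ J, (if q k then z k else 1) ≤ ∑ k ∈ J, if q k then z k else 0 := by
  classical
  obtain ⟨k, hk, hqk⟩ := hq
  calc ∏ k ∈ J, (if q k then z k else 1) = z k * ∏ l ∈ J.erase k, if q l then z l else 1 := by
        rw [← mul_prod_erase _ _ hk, if_pos hqk]
    _ ≤ z k := by
        refine mul_le_of_le_one_right (hz k hk) (prod_le_one (fun l hl => ?_) fun l hl => ?_) <;>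
          split_ifs
        exacts [hz l (mem_of_mem_erase hl), zero_le_one, hz1 l (mem_of_mem_erase hl), le_rfl]
    _ = if q k then z k else 0 := (if_pos hqk).symm
    _ ≤ ∑ k ∈ J, if q k then z k else 0 := by
        refine single_le_sum (f := fun k => if q k then z k else 0) (fun l hl => ?_) hk
        split_ifs
        exacts [hz l hl, le_rfl]

theorem card_filter_powerset_le (P : Finset ι) (J : Finset κ) (q : κ → ι → Prop)
    [∀ k, DecidablePred (q k)] (hq : ∀ i ∈ P, ∃ k ∈ J, q k i) (T : κ → ℝ)
    [DecidablePred fun S : Finset ι => ∀ k ∈ J, ((S.filter (q k)).card : ℝ) < T k] {z : κ → ℝ}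
    (hz : ∀ k ∈ J, 0 < z k) (hz1 : ∀ k ∈ J, z k ≤ 1) :
    ((P.powerset.filter fun S => ∀ k ∈ J, ((S.filter (q k)).card : ℝ) < T k).card : ℝ) ≤
      Real.exp (∑ k ∈ J, (T k * -Real.log (z k) + (P.filter (q k)).card * z k)) := by
  set y : ι → ℝ := fun i => ∏ k ∈ J, if q k i then z k else 1
  set C := Real.exp (∑ k ∈ J, T k * -Real.log (z k)) with hC
  have hy0 : ∀ i, 0 ≤ y i := fun i => prod_nonneg fun k hk => by
    split_ifs
    exacts [(hz k hk).le, zero_le_one]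
  have hyS : ∀ S : Finset ι, ∏ i ∈ S, y i =
      Real.exp (∑ k ∈ J, (S.filter (q k)).card * Real.log (z k)) := fun S => by
    rw [Finset.prod_comm, Real.exp_sum]
    exact prod_congr rfl fun k hk => prod_ite_one_eq_exp S (q k) (hz k hk)
  have hsumy : ∑ i ∈ P, y i ≤ ∑ k ∈ J, (P.filter (q k)).card * z k := by
    refine (sum_le_sum fun i hi =>
      prod_ite_one_le_sum_ite J (q · i) (fun k hk => (hz k hk).le) hz1 (hq i hi)).trans_eq ?_
    rw [sum_comm]
    exact sum_congr rfl fun k _ => by rw [← sum_filter, sum_const, nsmul_eq_mul]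
  rw [card_eq_sum_ones, Nat.cast_sum, Nat.cast_one]
  calc ∑ S ∈ P.powerset with ∀ k ∈ J, ((S.filter (q k)).card : ℝ) < T k, (1 : ℝ)
      ≤ ∑ S ∈ P.powerset, C * (∏ i ∈ S, y i) * 1 := by
        refine sum_filter_le_sum_mul _ _ (fun _ _ => zero_le_one)
          (fun S _ => mul_nonneg (Real.exp_pos _).le (prod_nonneg fun _ _ => hy0 _))
          fun S _ hS => ?_
        rw [hyS, hC, ← Real.exp_add, ← sum_add_distrib]
        refine Real.one_le_exp (sum_nonneg fun k hk => ?_)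
        nlinarith [hS k hk, Real.log_nonpos (hz k hk).le (hz1 k hk)]
    _ = C * ∏ i ∈ P, (1 + (0 + y i)) := by
        simp only [mul_one, zero_add, ← mul_sum, prod_one_add]
    _ ≤ C * (Real.exp (∑ i ∈ P, y i) * ∏ _ ∈ P, (1 + 0)) :=
        mul_le_mul_of_nonneg_left
          (prod_one_add_add_le P (fun _ _ => le_rfl) fun _ _ => hy0 _) (Real.exp_pos _).le
    _ = C * Real.exp (∑ i ∈ P, y i) := by rw [add_zero, prod_const_one, mul_one]
    _ ≤ C * Real.exp (∑ k ∈ J, (P.filter (q k)).card * z k) :=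
        mul_le_mul_of_nonneg_left (Real.exp_le_exp.2 hsumy) (Real.exp_pos _).le
    _ = _ := by rw [hC, ← Real.exp_add, ← sum_add_distrib]

variable [DecidableEq ι]

theorem sum_powerset_sum_powerset_prod (P : Finset ι) (u v : ι → ℝ) :
    ∑ S ∈ P.powerset, ∑ R ∈ S.powerset, (∏ i ∈ R, u i) * ∏ i ∈ S \ R, v i =
      ∏ i ∈ P, (1 + (u i + v i)) := by
  rw [prod_one_add]
  exact sum_congr rfl fun S _ => (prod_add u v S).symm

theorem sum_powerset_sum_filter_prod_le (P : Finset ι) {u v N : ι → ℝ} (hu : ∀ i ∈ P, 0 ≤ u i)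
    (hv : ∀ i ∈ P, 0 ≤ v i) (hN : ∀ i ∈ P, 0 ≤ N i) {X : ℝ} (hX : 0 < X) {α : ℝ} (hα : 0 ≤ α) :
    ∑ S ∈ P.powerset, ∑ R ∈ S.powerset with X ≤ ∏ i ∈ S \ R, N i,
        (∏ i ∈ R, u i) * ∏ i ∈ S \ R, v i ≤
      Real.exp (-(α * Real.log X) + ∑ i ∈ P, v i * N i ^ α) * ∏ i ∈ P, (1 + (u i + v i)) := by
  have hvN : ∀ i ∈ P, 0 ≤ v i * N i ^ α := fun i hi =>
    mul_nonneg (hv i hi) (Real.rpow_nonneg (hN i hi) _)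
  have hXα : Real.exp (-(α * Real.log X)) = (X ^ α)⁻¹ := by
    rw [Real.exp_neg, Real.rpow_def_of_pos hX, mul_comm]
  calc _ ≤ ∑ S ∈ P.powerset, ∑ R ∈ S.powerset, (X ^ α)⁻¹ * (∏ i ∈ S \ R, N i) ^ α *
          ((∏ i ∈ R, u i) * ∏ i ∈ S \ R, v i) := by
        refine sum_le_sum fun S hS => ?_
        rw [mem_powerset] at hS
        refine sum_filter_le_sum_mul _ _ (fun R hR => ?_) (fun _ _ => ?_) fun R _ hR => ?_
        · exact mul_nonneg (prod_nonneg fun i hi => hu i (hS (mem_powerset.1 hR hi)))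
            (prod_nonneg fun i hi => hv i (hS (sdiff_subset hi)))
        · exact mul_nonneg (by positivity)
            (Real.rpow_nonneg (prod_nonneg fun i hi => hN i (hS (sdiff_subset hi))) _)
        · rw [inv_mul_eq_div, one_le_div (by positivity)]
          exact Real.rpow_le_rpow hX.le hR hα
    _ = ∑ S ∈ P.powerset, ∑ R ∈ S.powerset, (X ^ α)⁻¹ *
          ((∏ i ∈ R, u i) * ∏ i ∈ S \ R, v i * N i ^ α) := by
        refine sum_congr rfl fun S hS => sum_congr rfl fun R _ => ?_
        rw [prod_mul_distrib, Real.finsetProd_rpow _ _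
          fun i hi => hN i (mem_powerset.1 hS (sdiff_subset hi))]
        ring
    _ = (X ^ α)⁻¹ * ∏ i ∈ P, (1 + (u i + v i * N i ^ α)) := by
        simp_rw [← mul_sum]
        rw [sum_powerset_sum_powerset_prod]
    _ ≤ (X ^ α)⁻¹ * ∏ i ∈ P, (1 + ((u i + v i) + v i * N i ^ α)) := by
        refine mul_le_mul_of_nonneg_left (prod_le_prod (fun i hi => ?_) fun i hi => ?_)
          (by positivity) <;> linarith [hu i hi, hv i hi, hvN i hi]
    _ ≤ (X ^ α)⁻¹ * (Real.exp (∑ i ∈ P, v i * N i ^ α) * ∏ i ∈ P, (1 + (u i + v i))) :=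
        mul_le_mul_of_nonneg_left
          (prod_one_add_add_le P (fun i hi => add_nonneg (hu i hi) (hv i hi)) hvN) (by positivity)
    _ = _ := by rw [Real.exp_add, hXα, mul_assoc]

theorem prod_one_add_mul_one_sub_le_sum (P : Finset ι) {u v N : ι → ℝ} (hu : ∀ i ∈ P, 0 ≤ u i)
    (hv : ∀ i ∈ P, 0 ≤ v i) (hN : ∀ i ∈ P, 0 ≤ N i) {X : ℝ} (hX : 0 < X) {α : ℝ} (hα : 0 ≤ α)
    (J : Finset κ) (q : κ → ι → Prop) [∀ k, DecidablePred (q k)] (T : κ → ℝ)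
    [DecidablePred fun S : Finset ι => ∀ k ∈ J, ((S.filter (q k)).card : ℝ) < T k] {b : ℝ}
    (hb : 1 ≤ b) :
    (∏ i ∈ P, (1 + (u i + v i))) *
        (1 - ∑ k ∈ J, Real.exp (-(T k * Real.log b) + (b - 1) * ∑ i ∈ P with q k i, (u i + v i)) -
          Real.exp (-(α * Real.log X) + ∑ i ∈ P, v i * N i ^ α)) ≤
      ∑ S ∈ P.powerset with ∀ k ∈ J, ((S.filter (q k)).card : ℝ) < T k,
        ∑ R ∈ S.powerset with ∏ i ∈ S \ R, N i < X, (∏ i ∈ R, u i) * ∏ i ∈ S \ R, v i := by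
  classical
  set W : Finset ι → Finset ι → ℝ := fun S R => (∏ i ∈ R, u i) * ∏ i ∈ S \ R, v i
  set Large : Finset ι → ℝ := fun S => ∑ R ∈ S.powerset with X ≤ ∏ i ∈ S \ R, N i, W S R
  have hW : ∀ S ∈ P.powerset, ∀ R ∈ S.powerset, 0 ≤ W S R := fun S hS R hR => by
    rw [mem_powerset] at hS hR
    exact mul_nonneg (prod_nonneg fun i hi => hu i (hS (hR hi)))
      (prod_nonneg fun i hi => hv i (hS (sdiff_subset hi)))
  have hunion := sum_le_sum_filter_add_sum_sum_filter P.powerset J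
    (fun k S => T k ≤ ((S.filter (q k)).card : ℝ)) (w := fun S => ∑ R ∈ S.powerset, W S R)
    fun S hS => sum_nonneg (hW S hS)
  simp only [not_le] at hunion
  have hsmall : ∀ S, ∑ R ∈ S.powerset, W S R =
      (∑ R ∈ S.powerset with ∏ i ∈ S \ R, N i < X, W S R) + Large S := fun S => by
    simpa only [not_lt] using
      (sum_filter_add_sum_filter_not S.powerset (fun R => ∏ i ∈ S \ R, N i < X) (W S)).symm
  have hgood : ∑ S ∈ P.powerset with ∀ k ∈ J, ((S.filter (q k)).card : ℝ) < T k, Large S ≤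
      ∑ S ∈ P.powerset, Large S :=
    sum_le_sum_of_subset_of_nonneg (filter_subset _ _) fun S hS _ =>
      sum_nonneg fun R hR => hW S hS R (mem_filter.1 hR).1
  have hlarge := sum_powerset_sum_filter_prod_le P hu hv hN hX hα
  have hbad := sum_le_sum fun k (_ : k ∈ J) => sum_powerset_filter_card_le P (q k)
    (fun i hi => add_nonneg (hu i hi) (hv i hi)) hb (T k)
  rw [← sum_mul] at hbad
  have hWS : ∀ S, ∑ R ∈ S.powerset, W S R = ∏ i ∈ S, (u i + v i) := fun S =>
    (prod_add u v S).symm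
  simp only [← hWS] at hbad
  have htotal : ∑ S ∈ P.powerset, ∑ R ∈ S.powerset, W S R = ∏ i ∈ P, (1 + (u i + v i)) :=
    sum_powerset_sum_powerset_prod P u v
  have hsplit : ∑ S ∈ P.powerset with ∀ k ∈ J, ((S.filter (q k)).card : ℝ) < T k,
      ∑ R ∈ S.powerset, W S R = _ := sum_congr rfl fun S _ => hsmall S
  rw [sum_add_distrib] at hsplit
  linarith

end RankinTrick

section PrimeSets

open UniqueFactorizationMonoid

/-- The indices `k` of the shells `ℙ_k`. -/
def shellIndices (γ : ℝ) (M : ℕ) : Finset ℕ := Finset.Icc 1 (shellCount γ M - 1)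

/-- The strict upper bound `a log M / (k² log₃ M)` for the number of prime factors in `ℙ_k` of an
element of `𝓜`. -/
def shellBound (a : ℝ) (M k : ℕ) : ℝ := a * iterLog 1 M / ((k : ℝ) ^ 2 * iterLog 3 M)

variable (K : Type*) [Field K] [NumberField K]

/-- The set `ℙ` as a `Finset`. -/
def primeFinset (γ : ℝ) (M : ℕ) : Finset (Ideal (𝓞 K)) := (resonatorPrimes_finite K γ M).toFinset

open Classical in
/-- The sets of prime factors of the elements of `𝓜`. As these are squarefree, `𝓜` is studied
through these sets. -/
def goodSets (γ a : ℝ) (M : ℕ) : Finset (Finset (Ideal (𝓞 K))) :=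
  (primeFinset K γ M).powerset.filter fun S => ∀ k ∈ shellIndices γ M,
    ((S.filter (· ∈ shellPrimes K M k)).card : ℝ) < shellBound a M k

/-- The value `f(𝔭)` for `𝔭 ∈ ℙ`. -/
def primeValue {K : Type*} [Field K] (M : ℕ) (𝔭 : Ideal (𝓞 K)) : ℝ := amplitude M * primeWeight M 𝔭

variable {K} {γ a : ℝ} {M : ℕ} {𝔭 : Ideal (𝓞 K)} {R S : Finset (Ideal (𝓞 K))}

theorem prime_of_mem_shellPrimes {k : ℕ} (h : 𝔭 ∈ shellPrimes K M k) : Prime 𝔭 :=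
  Ideal.prime_of_isPrime h.2.1 h.1

theorem mem_primeFinset :
    𝔭 ∈ primeFinset K γ M ↔ ∃ k ∈ shellIndices γ M, 𝔭 ∈ shellPrimes K M k := by
  simp only [primeFinset, resonatorPrimes, shellIndices, Set.Finite.mem_toFinset, Set.mem_iUnion,
    exists_prop]

theorem prime_of_subset_primeFinset (hS : S ⊆ primeFinset K γ M) : ∀ 𝔭 ∈ S, Prime 𝔭 := by
  intro 𝔭 h𝔭
  obtain ⟨k, -, hk⟩ := mem_primeFinset.1 (hS h𝔭)
  exact prime_of_mem_shellPrimes hk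

theorem subset_primeFinset_of_mem_goodSets (hS : S ∈ goodSets K γ a M) : S ⊆ primeFinset K γ M :=
  Finset.mem_powerset.1 (Finset.mem_filter.1 hS).1

open Classical in
theorem mem_goodSets_of_subset (hS : S ∈ goodSets K γ a M) (hRS : R ⊆ S) :
    R ∈ goodSets K γ a M := by
  refine Finset.mem_filter.2
    ⟨Finset.mem_powerset.2 (hRS.trans (subset_primeFinset_of_mem_goodSets hS)), fun k hk => ?_⟩
  refine lt_of_le_of_lt ?_ ((Finset.mem_filter.1 hS).2 k hk)
  exact_mod_cast Finset.card_le_card (Finset.filter_subset_filter _ hRS)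

theorem prod_mem_supportIdeals (hS : S ⊆ primeFinset K γ M) :
    ∏ 𝔭 ∈ S, 𝔭 ∈ supportIdeals K γ M := by
  have hprime := prime_of_subset_primeFinset hS
  refine ⟨squarefree_prod_primes hprime, fun 𝔭 h𝔭 => ?_⟩
  rw [primeFactors_prod_primes hprime] at h𝔭
  exact (Set.Finite.mem_toFinset _).1 (hS h𝔭)

theorem injOn_prod_powerset_primeFinset :
    Set.InjOn (fun S : Finset (Ideal (𝓞 K)) => ∏ 𝔭 ∈ S, 𝔭) {S | S ⊆ primeFinset K γ M} :=
  Set.LeftInvOn.injOn fun _ hS => primeFactors_prod_primes (prime_of_subset_primeFinset hS)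

theorem injOn_prod_goodSets :
    Set.InjOn (fun S : Finset (Ideal (𝓞 K)) => ∏ 𝔭 ∈ S, 𝔭) (goodSets K γ a M) :=
  injOn_prod_powerset_primeFinset.mono fun _ => subset_primeFinset_of_mem_goodSets

theorem mem_resonatorSet_iff {𝔫 : Ideal (𝓞 K)} :
    𝔫 ∈ resonatorSet K γ a M ↔ ∃ S ∈ goodSets K γ a M, ∏ 𝔭 ∈ S, 𝔭 = 𝔫 := by
  constructor
  · rintro ⟨⟨hsq, hsub⟩, hcard⟩
    refine ⟨primeFactors 𝔫, Finset.mem_filter.2 ⟨Finset.mem_powerset.2 fun 𝔭 h𝔭 => ?_, hcard⟩,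
      prod_primeFactors_of_squarefree hsq⟩
    exact (Set.Finite.mem_toFinset _).2 (hsub 𝔭 h𝔭)
  · rintro ⟨S, hS, rfl⟩
    have hP := subset_primeFinset_of_mem_goodSets hS
    refine ⟨prod_mem_supportIdeals hP, fun k hk => ?_⟩
    rw [primeFactors_prod_primes (prime_of_subset_primeFinset hP)]
    exact (Finset.mem_filter.1 hS).2 k hk

open Classical in
theorem resonatorSet_eq_coe_image : resonatorSet K γ a M =
    ((goodSets K γ a M).image fun S => ∏ 𝔭 ∈ S, 𝔭 : Finset (Ideal (𝓞 K))) := by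
  ext 𝔫
  rw [mem_resonatorSet_iff, Finset.mem_coe, Finset.mem_image]

theorem encard_resonatorSet : (resonatorSet K γ a M).encard = (goodSets K γ a M).card := by
  rw [resonatorSet_eq_coe_image, Set.encard_coe_eq_coe_finsetCard,
    Finset.card_image_of_injOn injOn_prod_goodSets]

theorem resonator_prod (hS : S ⊆ primeFinset K γ M) :
    resonator γ M (∏ 𝔭 ∈ S, 𝔭) = ∏ 𝔭 ∈ S, primeValue M 𝔭 := by
  rw [resonator, if_pos (prod_mem_supportIdeals hS),
    primeFactors_prod_primes (prime_of_subset_primeFinset hS)]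
  rfl

theorem finsum_resonator_sq :
    ∑ᶠ 𝔪 ∈ resonatorSet K γ a M, resonator γ M 𝔪 ^ 2 =
      ∑ S ∈ goodSets K γ a M, ∏ 𝔭 ∈ S, primeValue M 𝔭 ^ 2 := by
  rw [resonatorSet_eq_coe_image, finsum_mem_coe_finset, Finset.sum_image injOn_prod_goodSets]
  refine Finset.sum_congr rfl fun S hS => ?_
  rw [resonator_prod (subset_primeFinset_of_mem_goodSets hS), Finset.prod_pow]

open Classical in
theorem normQuot_prod (hS : S ⊆ primeFinset K γ M) (hRS : R ⊆ S) :
    normQuot (∏ 𝔭 ∈ S, 𝔭) (∏ 𝔭 ∈ R, 𝔭) = ∏ 𝔭 ∈ S \ R, (Ideal.absNorm 𝔭 : ℝ) := by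
  have hne : (∏ 𝔭 ∈ R, (Ideal.absNorm 𝔭 : ℝ)) ≠ 0 := Finset.prod_ne_zero_iff.2 fun 𝔭 h𝔭 => by
    exact_mod_cast (absNorm_pos (prime_of_subset_primeFinset hS 𝔭 (hRS h𝔭))).ne'
  rw [normQuot, map_prod, map_prod, Nat.cast_prod, Nat.cast_prod, div_eq_iff hne,
    Finset.prod_sdiff hRS]

open Classical in
/-- The pairs `R ⊆ S` of sets of prime ideals, stored as `⟨S, R⟩`, for which `(∏ R, ∏ S)` is one of
the pairs of `resonancePairs`. -/
def goodPairs (K : Type*) [Field K] [NumberField K] (γ a : ℝ) (M D : ℕ) :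
    Finset (Σ _ : Finset (Ideal (𝓞 K)), Finset (Ideal (𝓞 K))) :=
  (goodSets K γ a M).sigma fun S =>
    S.powerset.filter fun R => ∏ 𝔭 ∈ S \ R, (Ideal.absNorm 𝔭 : ℝ) < √(D : ℝ)

variable {D : ℕ}

open Classical in
theorem mem_goodPairs_iff {x : Σ _ : Finset (Ideal (𝓞 K)), Finset (Ideal (𝓞 K))} :
    x ∈ goodPairs K γ a M D ↔ x.1 ∈ goodSets K γ a M ∧ x.2 ⊆ x.1 ∧
      ∏ 𝔭 ∈ x.1 \ x.2, (Ideal.absNorm 𝔭 : ℝ) < √(D : ℝ) := by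
  rw [goodPairs, Finset.mem_sigma, Finset.mem_filter, Finset.mem_powerset]

open Classical in
theorem resonancePairs_eq_coe_image : resonancePairs K γ a M D =
    ((goodPairs K γ a M D).image
      fun x => (∏ 𝔭 ∈ x.2, 𝔭, ∏ 𝔭 ∈ x.1, 𝔭) : Finset (Ideal (𝓞 K) × Ideal (𝓞 K))) := by
  ext ⟨𝔪, 𝔫⟩
  rw [Finset.mem_coe, Finset.mem_image]
  constructor
  · rintro ⟨hm, hn, hdvd, hnorm⟩
    obtain ⟨R, hR, rfl⟩ := mem_resonatorSet_iff.1 hm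
    obtain ⟨S, hS, rfl⟩ := mem_resonatorSet_iff.1 hn
    have hRP := subset_primeFinset_of_mem_goodSets hR
    have hSP := subset_primeFinset_of_mem_goodSets hS
    have hRS : R ⊆ S := (prod_primes_dvd_prod_primes_iff (prime_of_subset_primeFinset hRP)
      (prime_of_subset_primeFinset hSP)).1 hdvd
    exact ⟨⟨S, R⟩, mem_goodPairs_iff.2 ⟨hS, hRS, (normQuot_prod hSP hRS).symm.trans_lt hnorm⟩, rfl⟩
  · rintro ⟨⟨S, R⟩, hx, h⟩
    obtain ⟨rfl, rfl⟩ := Prod.mk.inj h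
    obtain ⟨hS, hRS, hnorm⟩ := mem_goodPairs_iff.1 hx
    have hSP := subset_primeFinset_of_mem_goodSets hS
    exact ⟨mem_resonatorSet_iff.2 ⟨R, mem_goodSets_of_subset hS hRS, rfl⟩,
      mem_resonatorSet_iff.2 ⟨S, hS, rfl⟩, Finset.prod_dvd_prod_of_subset _ _ _ hRS,
      (normQuot_prod hSP hRS).trans_lt hnorm⟩

theorem injOn_prod_goodPairs :
    Set.InjOn (fun x : Σ _ : Finset (Ideal (𝓞 K)), Finset (Ideal (𝓞 K)) =>
      (∏ 𝔭 ∈ x.2, 𝔭, ∏ 𝔭 ∈ x.1, 𝔭)) (goodPairs K γ a M D) := by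
  rintro ⟨S, R⟩ hx ⟨S', R'⟩ hx' h
  obtain ⟨hR, hS⟩ := Prod.mk.inj h
  obtain ⟨hgood, hRS, -⟩ := mem_goodPairs_iff.1 hx
  obtain ⟨hgood', hRS', -⟩ := mem_goodPairs_iff.1 hx'
  obtain rfl : S = S' := injOn_prod_goodSets hgood hgood' hS
  obtain rfl : R = R' := injOn_prod_goodSets (mem_goodSets_of_subset hgood hRS)
    (mem_goodSets_of_subset hgood hRS') hR
  rfl

open Classical in
theorem finsum_resonancePairs :
    ∑ᶠ x ∈ resonancePairs K γ a M D,
      resonator γ M x.1 * resonator γ M x.2 / √(normQuot x.2 x.1) =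
    ∑ S ∈ goodSets K γ a M, ∑ R ∈ S.powerset with
        ∏ 𝔭 ∈ S \ R, (Ideal.absNorm 𝔭 : ℝ) < √(D : ℝ),
      (∏ 𝔭 ∈ R, primeValue M 𝔭 ^ 2) *
        ∏ 𝔭 ∈ S \ R, primeValue M 𝔭 / √(Ideal.absNorm 𝔭 : ℝ) := by
  rw [resonancePairs_eq_coe_image, finsum_mem_coe_finset, Finset.sum_image injOn_prod_goodPairs,
    goodPairs, Finset.sum_sigma]
  refine Finset.sum_congr rfl fun S hS => Finset.sum_congr rfl fun R hR => ?_
  have hSP := subset_primeFinset_of_mem_goodSets hS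
  have hRS : R ⊆ S := Finset.mem_powerset.1 (Finset.mem_filter.1 hR).1
  rw [resonator_prod hSP, resonator_prod (hRS.trans hSP), normQuot_prod hSP hRS,
    Real.sqrt_prod _ fun 𝔭 _ => Nat.cast_nonneg _, Finset.prod_div_distrib, Finset.prod_pow,
    ← Finset.prod_sdiff hRS]
  ring

theorem amplitude_mul_primeSum :
    amplitude M * primeSum K γ M =
      ∑ 𝔭 ∈ primeFinset K γ M, primeValue M 𝔭 / √(Ideal.absNorm 𝔭 : ℝ) := by
  rw [primeSum, ← Set.Finite.coe_toFinset (resonatorPrimes_finite K γ M), finsum_mem_coe_finset,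
    Finset.mul_sum]
  refine Finset.sum_congr rfl fun 𝔭 _ => ?_
  rw [primeValue]
  ring

end PrimeSets

section IteratedLogarithms

theorem iterLog_succ (k : ℕ) (x : ℝ) : iterLog (k + 1) x = Real.log (iterLog k x) :=
  Function.iterate_succ_apply' _ _ _

theorem tendsto_iterLog_atTop (k : ℕ) : Tendsto (fun M : ℕ => iterLog k M) atTop atTop := by
  induction k with
  | zero => exact tendsto_natCast_atTop_atTop
  | succ k ih =>
    simp_rw [iterLog_succ]
    exact Real.tendsto_log_atTop.comp ih

/-- `M` is so large that `log M`, `log₂ M` and `log₃ M` are at least `1`. -/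
structure IsLarge (M : ℕ) : Prop where
  one_le_iterLog_one : 1 ≤ iterLog 1 M
  one_le_iterLog_two : 1 ≤ iterLog 2 M
  one_le_iterLog_three : 1 ≤ iterLog 3 M

theorem eventually_isLarge : ∀ᶠ M : ℕ in atTop, IsLarge M := by
  filter_upwards [(tendsto_iterLog_atTop 1).eventually_ge_atTop 1,
    (tendsto_iterLog_atTop 2).eventually_ge_atTop 1,
    (tendsto_iterLog_atTop 3).eventually_ge_atTop 1] with M h1 h2 h3 using ⟨h1, h2, h3⟩

namespace IsLarge

variable {M : ℕ} (h : IsLarge M)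

include h

theorem iterLog_one_pos : 0 < iterLog 1 M := one_pos.trans_le h.one_le_iterLog_one

theorem iterLog_two_pos : 0 < iterLog 2 M := one_pos.trans_le h.one_le_iterLog_two

theorem iterLog_three_pos : 0 < iterLog 3 M := one_pos.trans_le h.one_le_iterLog_three

theorem natCast_pos : (0 : ℝ) < M := by
  refine M.cast_nonneg.lt_of_ne fun hM => ?_
  have hlog := h.one_le_iterLog_one
  rw [iterLog_succ, iterLog, Function.iterate_zero_apply, ← hM, Real.log_zero] at hlog
  linarith

theorem exp_iterLog_one : Real.exp (iterLog 1 M) = M := Real.exp_log h.natCast_pos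

theorem exp_iterLog_two : Real.exp (iterLog 2 M) = iterLog 1 M := by
  rw [iterLog_succ 1, Real.exp_log h.iterLog_one_pos]

theorem iterLog_three_le_iterLog_two : iterLog 3 M ≤ iterLog 2 M := by
  rw [iterLog_succ 2]
  exact Real.log_le_self h.iterLog_two_pos.le

theorem log_iterLog_one_mul_iterLog_two :
    Real.log (iterLog 1 M * iterLog 2 M) = iterLog 2 M + iterLog 3 M := by
  rw [Real.log_mul h.iterLog_one_pos.ne' h.iterLog_two_pos.ne', ← iterLog_succ, ← iterLog_succ]

theorem amplitude_sq : amplitude M ^ 2 = iterLog 1 M * iterLog 2 M / iterLog 3 M := by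
  have h1 := h.iterLog_one_pos
  have h2 := h.iterLog_two_pos
  have h3 := h.iterLog_three_pos
  exact Real.sq_sqrt (by positivity)

end IsLarge

theorem amplitude_nonneg (M : ℕ) : 0 ≤ amplitude M := Real.sqrt_nonneg _

theorem eventually_iterLog_two_pow_le (n : ℕ) {ε : ℝ} (hε : 0 < ε) :
    ∀ᶠ M : ℕ in atTop, iterLog 2 M ^ n ≤ ε * iterLog 1 M := by
  have hlim := (Real.tendsto_pow_mul_exp_neg_atTop_nhds_zero n).comp (tendsto_iterLog_atTop 2)
  filter_upwards [eventually_isLarge, hlim.eventually_le_const hε] with M hM hsmall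
  rwa [Function.comp_apply, Real.exp_neg, hM.exp_iterLog_two, ← div_eq_mul_inv,
    div_le_iff₀ hM.iterLog_one_pos] at hsmall

theorem eventually_amplitude_mul_iterLog_two_le {δ : ℝ} (hδ : 0 < δ) :
    ∀ᶠ M : ℕ in atTop, amplitude M * iterLog 2 M ≤ δ * iterLog 1 M := by
  filter_upwards [eventually_isLarge, eventually_iterLog_two_pow_le 3 (pow_pos hδ 2)] with M hM hpow
  have h1 := hM.iterLog_one_pos
  have h2 := hM.iterLog_two_pos
  refine le_of_sq_le_sq ?_ (by positivity)
  calc (amplitude M * iterLog 2 M) ^ 2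
      = iterLog 1 M * iterLog 2 M ^ 3 / iterLog 3 M := by
        rw [mul_pow, hM.amplitude_sq]
        ring
    _ ≤ iterLog 1 M * iterLog 2 M ^ 3 := div_le_self (by positivity) hM.one_le_iterLog_three
    _ ≤ iterLog 1 M * (δ ^ 2 * iterLog 1 M) := mul_le_mul_of_nonneg_left hpow h1.le
    _ = (δ * iterLog 1 M) ^ 2 := by ring

/-- The bound furnished by Rankin's trick for the share of the sets of prime ideals violating one of
the cardinality constraints. -/
def shellError (c : ℝ) (M : ℕ) : ℝ :=
  iterLog 2 M * Real.exp (-(c * (iterLog 1 M / (iterLog 3 M * iterLog 2 M ^ 2))))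

/-- The bound furnished by Rankin's trick for the share of the pairs `𝔪 ∣ 𝔫` whose quotient has
norm at least `√D`. -/
def normError (C : ℝ) (M : ℕ) : ℝ :=
  Real.exp (-(iterLog 1 M / (2 * iterLog 2 M)) + C * amplitude M)

theorem tendsto_shellError {c : ℝ} (hc : 0 < c) : Tendsto (shellError c) atTop (𝓝 0) := by
  have hlim : Tendsto (fun M : ℕ => iterLog 2 M * Real.exp (-iterLog 2 M)) atTop (𝓝 0) := by
    simpa only [Function.comp_def, pow_one] using
      (Real.tendsto_pow_mul_exp_neg_atTop_nhds_zero 1).comp (tendsto_iterLog_atTop 2)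
  refine tendsto_of_tendsto_of_tendsto_of_le_of_le' tendsto_const_nhds hlim ?_ ?_
  · filter_upwards [eventually_isLarge] with M hM
    exact mul_nonneg hM.iterLog_two_pos.le (Real.exp_pos _).le
  filter_upwards [eventually_isLarge, eventually_iterLog_two_pow_le 4 hc] with M hM hpow
  have h2 := hM.iterLog_two_pos
  have h3 := hM.iterLog_three_pos
  refine mul_le_mul_of_nonneg_left (Real.exp_le_exp.2 (neg_le_neg ?_)) h2.le
  rw [mul_div_assoc', le_div_iff₀ (by positivity)]
  calc iterLog 2 M * (iterLog 3 M * iterLog 2 M ^ 2)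
      ≤ iterLog 2 M * (iterLog 2 M * iterLog 2 M ^ 2) := by
        gcongr
        exact hM.iterLog_three_le_iterLog_two
    _ = iterLog 2 M ^ 4 := by ring
    _ ≤ c * iterLog 1 M := hpow

theorem tendsto_normError {C : ℝ} (hC : 0 < C) : Tendsto (normError C) atTop (𝓝 0) := by
  have hlim : Tendsto (fun M : ℕ => Real.exp (-iterLog 2 M)) atTop (𝓝 0) :=
    Real.tendsto_exp_neg_atTop_nhds_zero.comp (tendsto_iterLog_atTop 2)
  refine tendsto_of_tendsto_of_tendsto_of_le_of_le' tendsto_const_nhds hlim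
    (Eventually.of_forall fun M => (Real.exp_pos _).le) ?_
  filter_upwards [eventually_isLarge, eventually_iterLog_two_pow_le 2 (ε := 1 / 4) (by norm_num),
    eventually_amplitude_mul_iterLog_two_le (δ := 1 / (4 * C)) (by positivity)] with M hM hpow hA
  refine Real.exp_le_exp.2 ?_
  have hCA : C * (amplitude M * iterLog 2 M) ≤ iterLog 1 M / 4 :=
    (mul_le_mul_of_nonneg_left hA hC.le).trans_eq (by field_simp)
  have hsum : iterLog 2 M + C * amplitude M ≤ iterLog 1 M / (2 * iterLog 2 M) := by
    rw [le_div_iff₀ (mul_pos two_pos hM.iterLog_two_pos)]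
    linarith
  linarith

theorem eventually_iterLog_one_div_mul_le {γ a : ℝ} (haγ : a * γ < 1) (C : ℝ) :
    ∀ᶠ M : ℕ in atTop, iterLog 1 M / iterLog 3 M *
      (a * (γ * iterLog 3 M + 2 * Real.log (iterLog 3 M)) + C) ≤ iterLog 1 M := by
  have hlog : Tendsto (fun M : ℕ => Real.log (iterLog 3 M) / iterLog 3 M) atTop (𝓝 0) :=
    Real.isLittleO_log_id_atTop.tendsto_div_nhds_zero.comp (tendsto_iterLog_atTop 3)
  have hinv : Tendsto (fun M : ℕ => C / iterLog 3 M) atTop (𝓝 0) :=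
    (tendsto_iterLog_atTop 3).const_div_atTop C
  have hlim : Tendsto (fun M : ℕ => a * γ + 2 * a * (Real.log (iterLog 3 M) / iterLog 3 M) +
      C / iterLog 3 M) atTop (𝓝 (a * γ)) := by
    simpa only [mul_zero, add_zero] using ((hlog.const_mul (2 * a)).const_add (a * γ)).add hinv
  filter_upwards [hlim.eventually_le_const haγ, eventually_isLarge] with M hle hM
  have h3 := hM.iterLog_three_pos
  calc iterLog 1 M / iterLog 3 M * (a * (γ * iterLog 3 M + 2 * Real.log (iterLog 3 M)) + C)
      = iterLog 1 M * (a * γ + 2 * a * (Real.log (iterLog 3 M) / iterLog 3 M) +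
          C / iterLog 3 M) := by field_simp
    _ ≤ iterLog 1 M := mul_le_of_le_one_right hM.iterLog_one_pos.le hle

end IteratedLogarithms

section Shells

open Module

theorem eventually_sum_shellPrimes_le {δ : ℝ} (hδ : 0 < δ) :
    ∀ᶠ M : ℕ in atTop, ∀ (K : Type*) [Field K] [NumberField K] (k : ℕ) (S : Finset (Ideal (𝓞 K))),
      (∀ 𝔭 ∈ S, 𝔭 ∈ shellPrimes K M k) →
        ∑ 𝔭 ∈ S, 1 / (primeBelow 𝔭 : ℝ) ≤ finrank ℚ K * ((1 + δ) / iterLog 2 M) := by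
  obtain ⟨x₀, hx₀⟩ := eventually_atTop.1 (eventually_sum_one_div_prime_le zero_le_one hδ)
  filter_upwards [(tendsto_iterLog_atTop 1).eventually_ge_atTop x₀, eventually_isLarge]
    with M hx₀M hM K _ _ k S hS
  have h2 := hM.iterLog_two_pos
  have hpos : 0 < iterLog 1 M * iterLog 2 M := mul_pos hM.iterLog_one_pos h2
  set x := Real.exp k * (iterLog 1 M * iterLog 2 M) with hx
  have hx₀x : x₀ ≤ x := calc
    x₀ ≤ iterLog 1 M := hx₀M
    _ ≤ iterLog 1 M * iterLog 2 M :=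
      le_mul_of_one_le_right hM.iterLog_one_pos.le hM.one_le_iterLog_two
    _ ≤ x := le_mul_of_one_le_left hpos.le (Real.one_le_exp k.cast_nonneg)
  have hlogx : iterLog 2 M ≤ Real.log x := by
    rw [hx, Real.log_mul (Real.exp_pos _).ne' hpos.ne', Real.log_exp,
      hM.log_iterLog_one_mul_iterLog_two]
    linarith [hM.iterLog_three_pos, k.cast_nonneg (α := ℝ)]
  have hprimes : ∀ p ∈ S.image primeBelow, p.Prime ∧ x < p ∧ (p : ℝ) ≤ Real.exp 1 * x := by
    intro p hp
    obtain ⟨𝔭, h𝔭, rfl⟩ := Finset.mem_image.1 hp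
    obtain ⟨-, -, hlt, hle⟩ := hS 𝔭 h𝔭
    refine ⟨primeBelow_prime (prime_of_mem_shellPrimes (hS 𝔭 h𝔭)), hlt, hle.trans_eq ?_⟩
    rw [hx, add_comm, Real.exp_add, mul_assoc]
  refine (sum_comp_primeBelow_le (fun 𝔭 h => prime_of_mem_shellPrimes (hS 𝔭 h))
    (φ := fun p => 1 / (p : ℝ)) fun n => by positivity).trans ?_
  gcongr
  exact (hx₀ x hx₀x _ hprimes).trans (by gcongr)

variable {K : Type*} [Field K] {M k : ℕ} {𝔭 : Ideal (𝓞 K)}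

theorem lt_log_primeBelow_sub (hM : IsLarge M) (h𝔭 : 𝔭 ∈ shellPrimes K M k) :
    (k : ℝ) < Real.log (primeBelow 𝔭) - iterLog 2 M - iterLog 3 M := by
  have hpos : 0 < iterLog 1 M * iterLog 2 M := mul_pos hM.iterLog_one_pos hM.iterLog_two_pos
  have hlog := Real.log_lt_log (by positivity) h𝔭.2.2.1
  rw [Real.log_mul (Real.exp_pos _).ne' hpos.ne', Real.log_exp,
    hM.log_iterLog_one_mul_iterLog_two] at hlog
  linarith

theorem iterLog_one_mul_iterLog_two_le_primeBelow (hM : IsLarge M) (h𝔭 : 𝔭 ∈ shellPrimes K M k) :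
    iterLog 1 M * iterLog 2 M ≤ primeBelow 𝔭 :=
  (le_mul_of_one_le_left (mul_pos hM.iterLog_one_pos hM.iterLog_two_pos).le
    (Real.one_le_exp k.cast_nonneg)).trans h𝔭.2.2.1.le

theorem primeWeight_nonneg (hM : IsLarge M) (h𝔭 : 𝔭 ∈ shellPrimes K M k) :
    0 ≤ primeWeight M 𝔭 :=
  one_div_nonneg.2 (mul_nonneg (Real.sqrt_nonneg _)
    (k.cast_nonneg.trans (lt_log_primeBelow_sub hM h𝔭).le))

theorem primeValue_nonneg (hM : IsLarge M) (h𝔭 : 𝔭 ∈ shellPrimes K M k) : 0 ≤ primeValue M 𝔭 :=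
  mul_nonneg (amplitude_nonneg M) (primeWeight_nonneg hM h𝔭)

variable [NumberField K]

theorem primeBelow_pos_of_mem_shellPrimes (h𝔭 : 𝔭 ∈ shellPrimes K M k) :
    (0 : ℝ) < primeBelow 𝔭 := by
  exact_mod_cast (primeBelow_prime (prime_of_mem_shellPrimes h𝔭)).pos

theorem primeWeight_le (hM : IsLarge M) (hk : 1 ≤ k) (h𝔭 : 𝔭 ∈ shellPrimes K M k) :
    primeWeight M 𝔭 ≤ 1 / (√(primeBelow 𝔭 : ℝ) * k) := by
  have hp := primeBelow_pos_of_mem_shellPrimes h𝔭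
  have : (0 : ℝ) < k := by exact_mod_cast hk
  exact one_div_le_one_div_of_le (by positivity)
    (mul_le_mul_of_nonneg_left (lt_log_primeBelow_sub hM h𝔭).le (Real.sqrt_nonneg _))

theorem primeValue_sq_le (hM : IsLarge M) (hk : 1 ≤ k) (h𝔭 : 𝔭 ∈ shellPrimes K M k) :
    primeValue M 𝔭 ^ 2 ≤
      iterLog 1 M * iterLog 2 M / ((k : ℝ) ^ 2 * iterLog 3 M) * (1 / primeBelow 𝔭) := by
  have hp := primeBelow_pos_of_mem_shellPrimes h𝔭
  calc primeValue M 𝔭 ^ 2 = amplitude M ^ 2 * primeWeight M 𝔭 ^ 2 := mul_pow _ _ _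
    _ ≤ amplitude M ^ 2 * (1 / (√(primeBelow 𝔭 : ℝ) * k)) ^ 2 := by
        gcongr
        exacts [primeWeight_nonneg hM h𝔭, primeWeight_le hM hk h𝔭]
    _ = _ := by
        rw [hM.amplitude_sq, div_pow, mul_pow, Real.sq_sqrt hp.le]
        field_simp

theorem primeValue_sq_le_one_div (hM : IsLarge M) (hk : 1 ≤ k) (h𝔭 : 𝔭 ∈ shellPrimes K M k) :
    primeValue M 𝔭 ^ 2 ≤ 1 / iterLog 3 M := by
  have hp := primeBelow_pos_of_mem_shellPrimes h𝔭
  have h3 := hM.iterLog_three_pos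
  have hk2 : (1 : ℝ) ≤ (k : ℝ) ^ 2 := one_le_pow₀ (by exact_mod_cast hk)
  refine (primeValue_sq_le hM hk h𝔭).trans ?_
  rw [div_mul_div_comm, mul_one, div_le_div_iff₀ (by positivity) h3, one_mul]
  calc iterLog 1 M * iterLog 2 M * iterLog 3 M ≤ primeBelow 𝔭 * iterLog 3 M :=
        mul_le_mul_of_nonneg_right (iterLog_one_mul_iterLog_two_le_primeBelow hM h𝔭) h3.le
    _ ≤ (k : ℝ) ^ 2 * (primeBelow 𝔭 * iterLog 3 M) := le_mul_of_one_le_left (by positivity) hk2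
    _ = _ := by ring

theorem primeValue_div_sqrt_nonneg (hM : IsLarge M) (h𝔭 : 𝔭 ∈ shellPrimes K M k) :
    0 ≤ primeValue M 𝔭 / √(Ideal.absNorm 𝔭 : ℝ) :=
  div_nonneg (primeValue_nonneg hM h𝔭) (Real.sqrt_nonneg _)

theorem primeValue_div_sqrt_le (hM : IsLarge M) (hk : 1 ≤ k) (h𝔭 : 𝔭 ∈ shellPrimes K M k) :
    primeValue M 𝔭 / √(Ideal.absNorm 𝔭 : ℝ) ≤ amplitude M / k * (1 / primeBelow 𝔭) := by
  have hp := primeBelow_pos_of_mem_shellPrimes h𝔭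
  have hN : (primeBelow 𝔭 : ℝ) ≤ Ideal.absNorm 𝔭 := by
    exact_mod_cast primeBelow_le_absNorm (prime_of_mem_shellPrimes h𝔭)
  calc primeValue M 𝔭 / √(Ideal.absNorm 𝔭 : ℝ) ≤ primeValue M 𝔭 / √(primeBelow 𝔭 : ℝ) := by
        have := primeValue_nonneg hM h𝔭
        gcongr
    _ ≤ amplitude M * (1 / (√(primeBelow 𝔭 : ℝ) * k)) / √(primeBelow 𝔭 : ℝ) := by
        refine div_le_div_of_nonneg_right ?_ (Real.sqrt_nonneg _)
        exact mul_le_mul_of_nonneg_left (primeWeight_le hM hk h𝔭) (amplitude_nonneg M)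
    _ = amplitude M / k * (1 / (√(primeBelow 𝔭 : ℝ) * √(primeBelow 𝔭 : ℝ))) := by field_simp
    _ = _ := by rw [Real.mul_self_sqrt hp.le]

theorem primeValue_div_sqrt_le_one_div (hM : IsLarge M)
    (hA : amplitude M * iterLog 2 M ≤ iterLog 1 M) (hk : 1 ≤ k) (h𝔭 : 𝔭 ∈ shellPrimes K M k) :
    primeValue M 𝔭 / √(Ideal.absNorm 𝔭 : ℝ) ≤ 1 / iterLog 3 M := by
  have hp := primeBelow_pos_of_mem_shellPrimes h𝔭
  refine (primeValue_div_sqrt_le hM hk h𝔭).trans ?_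
  rw [div_mul_div_comm, mul_one, div_le_div_iff₀ (by positivity) hM.iterLog_three_pos, one_mul]
  calc amplitude M * iterLog 3 M ≤ amplitude M * iterLog 2 M :=
        mul_le_mul_of_nonneg_left hM.iterLog_three_le_iterLog_two (amplitude_nonneg M)
    _ ≤ iterLog 1 M := hA
    _ ≤ iterLog 1 M * iterLog 2 M :=
        le_mul_of_one_le_right hM.iterLog_one_pos.le hM.one_le_iterLog_two
    _ ≤ primeBelow 𝔭 := iterLog_one_mul_iterLog_two_le_primeBelow hM h𝔭
    _ ≤ k * primeBelow 𝔭 := le_mul_of_one_le_left hp.le (by exact_mod_cast hk)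

theorem absNorm_rpow_le (hM : IsLarge M) (hk : (k : ℝ) + 1 ≤ iterLog 2 M)
    (h𝔭 : 𝔭 ∈ shellPrimes K M k) :
    (Ideal.absNorm 𝔭 : ℝ) ^ (1 / iterLog 2 M) ≤ Real.exp (3 * finrank ℚ K) := by
  have hprime := prime_of_mem_shellPrimes h𝔭
  have hp := primeBelow_pos_of_mem_shellPrimes h𝔭
  have hN0 : (0 : ℝ) < Ideal.absNorm 𝔭 := by exact_mod_cast absNorm_pos hprime
  have hpos : 0 < iterLog 1 M * iterLog 2 M := mul_pos hM.iterLog_one_pos hM.iterLog_two_pos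
  have hlogp : Real.log (primeBelow 𝔭) ≤ 3 * iterLog 2 M := by
    refine (Real.log_le_log hp h𝔭.2.2.2).trans ?_
    rw [Real.log_mul (Real.exp_pos _).ne' hpos.ne', Real.log_exp,
      hM.log_iterLog_one_mul_iterLog_two]
    linarith [hM.iterLog_three_le_iterLog_two]
  rw [Real.rpow_def_of_pos hN0, Real.exp_le_exp, mul_one_div, div_le_iff₀ hM.iterLog_two_pos]
  calc Real.log (Ideal.absNorm 𝔭) ≤ Real.log ((primeBelow 𝔭 : ℝ) ^ finrank ℚ K) :=
        Real.log_le_log hN0 (by exact_mod_cast absNorm_le_primeBelow_pow_finrank hprime)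
    _ = finrank ℚ K * Real.log (primeBelow 𝔭) := Real.log_pow _ _
    _ ≤ finrank ℚ K * (3 * iterLog 2 M) := mul_le_mul_of_nonneg_left hlogp (Nat.cast_nonneg _)
    _ = _ := by ring

end Shells

section Cardinality

open Module

theorem add_one_le_of_mem_shellIndices {γ : ℝ} {M k : ℕ} (hM : IsLarge M)
    (hk : k ∈ shellIndices γ M) : (k : ℝ) + 1 ≤ iterLog 2 M ^ γ := by
  rw [shellIndices, Finset.mem_Icc] at hk
  have : k + 1 ≤ shellCount γ M := by omega
  exact (by exact_mod_cast this : (k : ℝ) + 1 ≤ shellCount γ M).trans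
    (Nat.floor_le (Real.rpow_nonneg hM.iterLog_two_pos.le γ))

theorem one_le_of_mem_shellIndices {γ : ℝ} {M k : ℕ} (hk : k ∈ shellIndices γ M) : 1 ≤ k :=
  (Finset.mem_Icc.1 hk).1

theorem card_shellIndices_le {γ : ℝ} {M : ℕ} (hM : IsLarge M) :
    ((shellIndices γ M).card : ℝ) ≤ iterLog 2 M ^ γ := by
  rw [shellIndices, Nat.card_Icc, Nat.add_sub_cancel]
  exact (Nat.cast_le.2 (Nat.sub_le _ _)).trans
    (Nat.floor_le (Real.rpow_nonneg hM.iterLog_two_pos.le γ))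

theorem sum_shellIndices_one_div_le {γ : ℝ} (hγ : 0 ≤ γ) {M : ℕ} (hM : IsLarge M) :
    ∑ k ∈ shellIndices γ M, 1 / (k : ℝ) ≤ 1 + γ * iterLog 3 M := by
  have hlog : Real.log (iterLog 2 M ^ γ) = γ * iterLog 3 M := by
    rw [Real.log_rpow hM.iterLog_two_pos, iterLog_succ 2]
  have hharm : ∑ k ∈ shellIndices γ M, 1 / (k : ℝ) = (harmonic (shellIndices γ M).card : ℝ) := by
    simp only [shellIndices, harmonic_eq_sum_Icc, one_div, Rat.cast_sum, Rat.cast_inv,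
      Rat.cast_natCast, Nat.card_Icc, Nat.add_sub_cancel]
  rw [hharm, ← hlog]
  refine (harmonic_le_one_add_log _).trans (add_le_add_right ?_ 1)
  rcases Nat.eq_zero_or_pos (shellIndices γ M).card with h0 | h0
  · rw [h0, Nat.cast_zero, Real.log_zero]
    exact Real.log_nonneg (Real.one_le_rpow hM.one_le_iterLog_two hγ)
  · exact Real.log_le_log (by exact_mod_cast h0) (card_shellIndices_le hM)

theorem sum_Icc_one_div_sq_le (n : ℕ) : ∑ k ∈ Finset.Icc 1 n, 1 / (k : ℝ) ^ 2 ≤ 2 := by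
  have hIoo : Finset.Icc 1 n = Finset.Ioo 0 (n + 1) := by
    ext k
    simp only [Finset.mem_Icc, Finset.mem_Ioo]
    omega
  simpa only [hIoo, one_div, Nat.cast_zero, zero_add, div_one] using
    sum_Ioo_inv_sq_le (α := ℝ) 0 (n + 1)

theorem summable_log_div_sq : Summable fun k : ℕ => Real.log k / (k : ℝ) ^ 2 := by
  have hlog := ((isLittleO_log_rpow_atTop (r := 1 / 2) (by norm_num)).comp_tendsto
    tendsto_natCast_atTop_atTop).isBigO.mul
      (Asymptotics.isBigO_refl (fun k : ℕ => ((k : ℝ) ^ 2)⁻¹) atTop)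
  refine summable_of_isBigO_nat (g := fun k : ℕ => ((k : ℝ) ^ (3 / 2 : ℝ))⁻¹)
    (Real.summable_nat_rpow_inv.2 (by norm_num)) (hlog.congr' .rfl ?_)
  filter_upwards [eventually_gt_atTop 0] with k hk
  have hk0 : (0 : ℝ) < k := by exact_mod_cast hk
  rw [Function.comp_apply, ← Real.rpow_natCast, ← Real.rpow_neg hk0.le, ← Real.rpow_neg hk0.le,
    ← Real.rpow_add hk0]
  norm_num

/-- The weight given to a prime ideal in `ℙ_k` when the elements of `𝓜` are counted by Rankin's
trick. -/
def rankinWeight (M k : ℕ) : ℝ := Real.exp (-k) / ((k : ℝ) ^ 2 * iterLog 3 M)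

theorem rankinWeight_pos {M k : ℕ} (hM : IsLarge M) (hk : 1 ≤ k) : 0 < rankinWeight M k := by
  have := hM.iterLog_three_pos
  rw [rankinWeight]
  positivity

theorem rankinWeight_le_one {M k : ℕ} (hM : IsLarge M) (hk : 1 ≤ k) : rankinWeight M k ≤ 1 := by
  refine div_le_one_of_le₀ ((Real.exp_le_one_iff.2 (neg_nonpos.2 k.cast_nonneg)).trans ?_) ?_
  · exact one_le_mul_of_one_le_of_one_le (one_le_pow₀ (by exact_mod_cast hk))
      hM.one_le_iterLog_three
  · have := hM.iterLog_three_pos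
    positivity

theorem neg_log_rankinWeight {M k : ℕ} (hM : IsLarge M) (hk : 1 ≤ k) :
    -Real.log (rankinWeight M k) = k + 2 * Real.log k + Real.log (iterLog 3 M) := by
  have h3 := hM.iterLog_three_pos
  rw [rankinWeight, Real.log_div (Real.exp_pos _).ne' (by positivity), Real.log_exp,
    Real.log_mul (by positivity) h3.ne', Real.log_pow]
  push_cast
  ring

theorem sum_shellBound_mul_neg_log_rankinWeight_le {γ a : ℝ} (hγ : 0 ≤ γ) (ha : 0 ≤ a) {M : ℕ}
    (hM : IsLarge M) :
    ∑ k ∈ shellIndices γ M, shellBound a M k * -Real.log (rankinWeight M k) ≤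
      iterLog 1 M / iterLog 3 M * (a * (γ * iterLog 3 M + 2 * Real.log (iterLog 3 M)) +
        a * (1 + 2 * ∑' k : ℕ, Real.log k / (k : ℝ) ^ 2)) := by
  have h1 := hM.iterLog_one_pos
  have h3 := hM.iterLog_three_pos
  calc ∑ k ∈ shellIndices γ M, shellBound a M k * -Real.log (rankinWeight M k)
      = iterLog 1 M / iterLog 3 M * (a * (∑ k ∈ shellIndices γ M, 1 / (k : ℝ) +
          2 * ∑ k ∈ shellIndices γ M, Real.log k / (k : ℝ) ^ 2 +
          Real.log (iterLog 3 M) * ∑ k ∈ shellIndices γ M, 1 / (k : ℝ) ^ 2)) := by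
        simp only [Finset.mul_sum, ← Finset.sum_add_distrib]
        refine Finset.sum_congr rfl fun k hk => ?_
        have hk1 := one_le_of_mem_shellIndices hk
        rw [neg_log_rankinWeight hM hk1, shellBound]
        field_simp
    _ ≤ iterLog 1 M / iterLog 3 M * (a * ((1 + γ * iterLog 3 M) +
          2 * (∑' k : ℕ, Real.log k / (k : ℝ) ^ 2) + Real.log (iterLog 3 M) * 2)) := by
        have hlog := Real.log_nonneg hM.one_le_iterLog_three
        gcongr
        · exact sum_shellIndices_one_div_le hγ hM
        · exact summable_log_div_sq.sum_le_tsum _ fun k _ =>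
            div_nonneg (Real.log_natCast_nonneg k) (by positivity)
        · exact sum_Icc_one_div_sq_le _
    _ = _ := by ring

theorem card_mul_rankinWeight_le {K : Type*} [Field K] [NumberField K] {M k : ℕ}
    {S : Finset (Ideal (𝓞 K))} (hS : ∀ 𝔭 ∈ S, 𝔭 ∈ shellPrimes K M k) (hM : IsLarge M) (hk : 1 ≤ k)
    (hsum : ∑ 𝔭 ∈ S, 1 / (primeBelow 𝔭 : ℝ) ≤ finrank ℚ K * ((1 + 1) / iterLog 2 M)) :
    S.card * rankinWeight M k ≤
      iterLog 1 M / iterLog 3 M * (2 * Real.exp 1 * finrank ℚ K * (1 / (k : ℝ) ^ 2)) := by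
  have h1 := hM.iterLog_one_pos
  have h2 := hM.iterLog_two_pos
  have h3 := hM.iterLog_three_pos
  have hcard : (S.card : ℝ) ≤ Real.exp (k + 1) * (iterLog 1 M * iterLog 2 M) *
      ∑ 𝔭 ∈ S, 1 / (primeBelow 𝔭 : ℝ) := by
    rw [Finset.mul_sum, Finset.card_eq_sum_ones, Nat.cast_sum, Nat.cast_one]
    refine Finset.sum_le_sum fun 𝔭 h𝔭 => ?_
    rw [mul_one_div, one_le_div (primeBelow_pos_of_mem_shellPrimes (hS 𝔭 h𝔭))]
    exact (hS 𝔭 h𝔭).2.2.2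
  calc S.card * rankinWeight M k
      ≤ Real.exp (k + 1) * (iterLog 1 M * iterLog 2 M) *
          (finrank ℚ K * ((1 + 1) / iterLog 2 M)) * rankinWeight M k :=
        mul_le_mul_of_nonneg_right (hcard.trans (by gcongr)) (rankinWeight_pos hM hk).le
    _ = _ := by
        rw [rankinWeight, Real.exp_add, Real.exp_neg]
        field_simp
        ring

open Classical in
theorem eventually_card_goodSets_le {γ a : ℝ} (hγ : 0 ≤ γ) (ha : 0 ≤ a) (haγ : a * γ < 1) (d : ℕ) :
    ∀ᶠ M : ℕ in atTop, ∀ (K : Type*) [Field K] [NumberField K], finrank ℚ K ≤ d →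
      (goodSets K γ a M).card ≤ M := by
  filter_upwards [eventually_isLarge, eventually_sum_shellPrimes_le one_pos,
    eventually_iterLog_one_div_mul_le haγ
      (a * (1 + 2 * ∑' k : ℕ, Real.log k / (k : ℝ) ^ 2) + 2 * Real.exp 1 * d * 2)]
    with M hM hshell hle K _ _ hK
  have h1 := hM.iterLog_one_pos
  have h3 := hM.iterLog_three_pos
  have hcard : ∑ k ∈ shellIndices γ M,
      (((primeFinset K γ M).filter (· ∈ shellPrimes K M k)).card : ℝ) * rankinWeight M k ≤
      iterLog 1 M / iterLog 3 M * (2 * Real.exp 1 * d * 2) := calc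
    _ ≤ ∑ k ∈ shellIndices γ M,
        iterLog 1 M / iterLog 3 M * (2 * Real.exp 1 * finrank ℚ K * (1 / (k : ℝ) ^ 2)) :=
      Finset.sum_le_sum fun k hk => card_mul_rankinWeight_le
        (fun 𝔭 h𝔭 => (Finset.mem_filter.1 h𝔭).2) hM (one_le_of_mem_shellIndices hk)
        (hshell K k _ fun 𝔭 h𝔭 => (Finset.mem_filter.1 h𝔭).2)
    _ = iterLog 1 M / iterLog 3 M * (2 * Real.exp 1 * finrank ℚ K *
        ∑ k ∈ shellIndices γ M, 1 / (k : ℝ) ^ 2) := by simp only [Finset.mul_sum]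
    _ ≤ _ := by
      gcongr
      exact sum_Icc_one_div_sq_le _
  have hrankin := card_filter_powerset_le (primeFinset K γ M) (shellIndices γ M)
    (fun k 𝔭 => 𝔭 ∈ shellPrimes K M k) (fun 𝔭 => mem_primeFinset.1) (shellBound a M)
    (fun k hk => rankinWeight_pos hM (one_le_of_mem_shellIndices hk))
    fun k hk => rankinWeight_le_one hM (one_le_of_mem_shellIndices hk)
  have hexp : ((goodSets K γ a M).card : ℝ) ≤ Real.exp (iterLog 1 M) := by
    refine hrankin.trans (Real.exp_le_exp.2 ?_)
    rw [Finset.sum_add_distrib]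
    linarith [sum_shellBound_mul_neg_log_rankinWeight_le hγ ha hM]
  rw [hM.exp_iterLog_one] at hexp
  exact_mod_cast hexp

end Cardinality

section LowerBound

open Module

theorem exists_rankin_constants {d a : ℝ} (hd : 0 < d) (ha : d < a) :
    ∃ δ c : ℝ, 0 < δ ∧ 0 < c ∧ (a / d - 1) * (d * (1 + δ) ^ 2) + c ≤ a * Real.log (a / d) := by
  have hgap : (a / d - 1) * d < a * Real.log (a / d) := by
    have ha0 : 0 < a := hd.trans ha
    have hlog : 1 - (a / d)⁻¹ < Real.log (a / d) := by
      have := Real.log_lt_sub_one_of_pos (inv_pos.2 (div_pos ha0 hd))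
        (inv_ne_one.2 ((one_lt_div hd).2 ha).ne')
      rw [Real.log_inv] at this
      linarith
    refine lt_of_eq_of_lt ?_ (mul_lt_mul_of_pos_left hlog ha0)
    field_simp
  have hcont : Continuous fun δ : ℝ => (a / d - 1) * (d * (1 + δ) ^ 2) := by fun_prop
  have hlim := hcont.tendsto 0
  simp only [add_zero, one_pow, mul_one] at hlim
  obtain ⟨δ, hδ, hδ0⟩ := ((hlim.mono_left nhdsWithin_le_nhds).eventually_lt_const hgap |>.and
    (self_mem_nhdsWithin (s := Set.Ioi (0 : ℝ)))).exists
  exact ⟨δ, _, hδ0, sub_pos.2 hδ, (add_sub_cancel _ _).le⟩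

theorem add_one_le_iterLog_two_of_mem_shellIndices {γ : ℝ} (hγ : γ ≤ 1) {M k : ℕ} (hM : IsLarge M)
    (hk : k ∈ shellIndices γ M) : (k : ℝ) + 1 ≤ iterLog 2 M :=
  (add_one_le_of_mem_shellIndices hM hk).trans
    (Real.rpow_le_self_of_one_le hM.one_le_iterLog_two hγ)

theorem card_shellIndices_le_iterLog_two {γ : ℝ} (hγ : γ ≤ 1) {M : ℕ} (hM : IsLarge M) :
    ((shellIndices γ M).card : ℝ) ≤ iterLog 2 M :=
  (card_shellIndices_le hM).trans (Real.rpow_le_self_of_one_le hM.one_le_iterLog_two hγ)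

theorem sum_primeValue_sq_add_le {K : Type*} [Field K] [NumberField K] {M k : ℕ}
    {S : Finset (Ideal (𝓞 K))} (hS : ∀ 𝔭 ∈ S, 𝔭 ∈ shellPrimes K M k) (hM : IsLarge M)
    (hk : 1 ≤ k) (hkM : (k : ℝ) ≤ iterLog 2 M) {δ : ℝ} (hδ : 0 ≤ δ)
    (hA : amplitude M * iterLog 2 M ≤ δ * iterLog 1 M)
    (hsum : ∑ 𝔭 ∈ S, 1 / (primeBelow 𝔭 : ℝ) ≤ finrank ℚ K * ((1 + δ) / iterLog 2 M)) :
    ∑ 𝔭 ∈ S, (primeValue M 𝔭 ^ 2 + primeValue M 𝔭 / √(Ideal.absNorm 𝔭 : ℝ)) ≤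
      finrank ℚ K * (1 + δ) ^ 2 * (iterLog 1 M / ((k : ℝ) ^ 2 * iterLog 3 M)) := by
  have h1 := hM.iterLog_one_pos
  have h2 := hM.iterLog_two_pos
  have h3 := hM.iterLog_three_pos
  set Q := iterLog 1 M * iterLog 2 M / ((k : ℝ) ^ 2 * iterLog 3 M) with hQ
  have hAk : amplitude M / k ≤ δ * Q := by
    have hk0 : (0 : ℝ) < k := by exact_mod_cast hk
    rw [mul_div_assoc', div_le_div_iff₀ hk0 (by positivity)]
    calc amplitude M * ((k : ℝ) ^ 2 * iterLog 3 M)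
        ≤ amplitude M * ((iterLog 2 M * k) * iterLog 2 M) := by
          rw [sq]
          gcongr
          exacts [amplitude_nonneg M, hM.iterLog_three_le_iterLog_two]
      _ = amplitude M * iterLog 2 M * (iterLog 2 M * k) := by ring
      _ ≤ δ * iterLog 1 M * (iterLog 2 M * k) := by gcongr
      _ = _ := by ring
  calc _ ≤ ∑ 𝔭 ∈ S, (1 + δ) * Q * (1 / (primeBelow 𝔭 : ℝ)) := by
        refine Finset.sum_le_sum fun 𝔭 h𝔭 => ?_
        have hp := primeBelow_pos_of_mem_shellPrimes (hS 𝔭 h𝔭)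
        have hv := (primeValue_div_sqrt_le hM hk (hS 𝔭 h𝔭)).trans
          (mul_le_mul_of_nonneg_right hAk (one_div_nonneg.2 hp.le))
        refine (add_le_add (primeValue_sq_le hM hk (hS 𝔭 h𝔭)) hv).trans_eq ?_
        ring
    _ = (1 + δ) * Q * ∑ 𝔭 ∈ S, 1 / (primeBelow 𝔭 : ℝ) := by rw [Finset.mul_sum]
    _ ≤ (1 + δ) * Q * (finrank ℚ K * ((1 + δ) / iterLog 2 M)) := by gcongr
    _ = _ := by
        rw [hQ]
        field_simp

open Classical in
theorem exists_eventually_sum_exp_shellBound_le {γ a : ℝ} {d : ℕ} (hγ : γ ≤ 1) (hd : 0 < d)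
    (ha : d < a) :
    ∃ c > 0, ∀ᶠ M : ℕ in atTop, ∀ (K : Type*) [Field K] [NumberField K], finrank ℚ K ≤ d →
      ∑ k ∈ shellIndices γ M, Real.exp (-(shellBound a M k * Real.log (a / d)) +
        (a / d - 1) * ∑ 𝔭 ∈ primeFinset K γ M with 𝔭 ∈ shellPrimes K M k,
          (primeValue M 𝔭 ^ 2 + primeValue M 𝔭 / √(Ideal.absNorm 𝔭 : ℝ))) ≤ shellError c M := by
  have hd0 : (0 : ℝ) < d := by exact_mod_cast hd
  obtain ⟨δ, c, hδ, hc, hδc⟩ := exists_rankin_constants hd0 ha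
  refine ⟨c, hc, ?_⟩
  filter_upwards [eventually_isLarge, eventually_sum_shellPrimes_le hδ,
    eventually_amplitude_mul_iterLog_two_le hδ] with M hM hshell hA K _ _ hK
  have h1 := hM.iterLog_one_pos
  have h3 := hM.iterLog_three_pos
  refine (Finset.sum_le_card_nsmul _ _
    (Real.exp (-(c * (iterLog 1 M / (iterLog 3 M * iterLog 2 M ^ 2)))))
    fun k hk => Real.exp_le_exp.2 ?_).trans ?_
  · have hk1 := one_le_of_mem_shellIndices hk
    have hkM : (k : ℝ) ≤ iterLog 2 M := by
      linarith [add_one_le_iterLog_two_of_mem_shellIndices hγ hM hk]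
    set Q := iterLog 1 M / ((k : ℝ) ^ 2 * iterLog 3 M) with hQ
    have hQ0 : 0 ≤ Q := by positivity
    have hweight := sum_primeValue_sq_add_le (S := (primeFinset K γ M).filter
      (· ∈ shellPrimes K M k)) (fun 𝔭 h𝔭 => (Finset.mem_filter.1 h𝔭).2) hM hk1 hkM hδ.le hA
      (hshell K k _ fun 𝔭 h𝔭 => (Finset.mem_filter.1 h𝔭).2)
    have hQle : iterLog 1 M / (iterLog 3 M * iterLog 2 M ^ 2) ≤ Q := by
      rw [hQ, mul_comm (iterLog 3 M)]
      gcongr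
    have hbound : shellBound a M k = a * Q := mul_div_assoc _ _ _
    have had : 0 ≤ a / d - 1 := sub_nonneg.2 ((one_le_div hd0).2 ha.le)
    calc _ ≤ -(a * Q * Real.log (a / d)) + (a / d - 1) * (d * (1 + δ) ^ 2 * Q) := by
          rw [hbound]
          gcongr
          exact hweight.trans (by gcongr)
      _ ≤ -(c * Q) := by linarith [mul_le_mul_of_nonneg_right hδc hQ0]
      _ ≤ _ := by gcongr
  · rw [nsmul_eq_mul, shellError]
    gcongr
    exact card_shellIndices_le_iterLog_two hγ hM

open Classical in
theorem eventually_sum_primeFinset_one_div_le {γ : ℝ} (hγ : γ ≤ 1) :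
    ∀ᶠ M : ℕ in atTop, ∀ (K : Type*) [Field K] [NumberField K],
      ∑ 𝔭 ∈ primeFinset K γ M, 1 / (primeBelow 𝔭 : ℝ) ≤ 2 * finrank ℚ K := by
  filter_upwards [eventually_isLarge, eventually_sum_shellPrimes_le one_pos]
    with M hM hshell K _ _
  have h2 := hM.iterLog_two_pos
  calc ∑ 𝔭 ∈ primeFinset K γ M, 1 / (primeBelow 𝔭 : ℝ)
      ≤ ∑ k ∈ shellIndices γ M, ∑ 𝔭 ∈ primeFinset K γ M with 𝔭 ∈ shellPrimes K M k,
          1 / (primeBelow 𝔭 : ℝ) :=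
        sum_le_sum_sum_filter _ _ _ (fun 𝔭 => mem_primeFinset.1) fun _ _ => by positivity
    _ ≤ (shellIndices γ M).card • (finrank ℚ K * ((1 + 1) / iterLog 2 M)) :=
        Finset.sum_le_card_nsmul _ _ _ fun k _ =>
          hshell K k _ fun 𝔭 h𝔭 => (Finset.mem_filter.1 h𝔭).2
    _ ≤ iterLog 2 M * (finrank ℚ K * ((1 + 1) / iterLog 2 M)) := by
        rw [nsmul_eq_mul]
        gcongr
        exact card_shellIndices_le_iterLog_two hγ hM
    _ = 2 * finrank ℚ K := by
        field_simp
        ring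

theorem eventually_exp_norm_le {γ : ℝ} (hγ : γ ≤ 1) (d : ℕ) :
    ∀ᶠ M : ℕ in atTop, ∀ (K : Type*) [Field K] [NumberField K], finrank ℚ K ≤ d →
      ∀ D : ℕ, M ≤ D → Real.exp (-(1 / iterLog 2 M * Real.log √(D : ℝ)) +
        ∑ 𝔭 ∈ primeFinset K γ M, primeValue M 𝔭 / √(Ideal.absNorm 𝔭 : ℝ) *
          (Ideal.absNorm 𝔭 : ℝ) ^ (1 / iterLog 2 M)) ≤ normError (2 * d * Real.exp (3 * d)) M := by
  filter_upwards [eventually_isLarge, eventually_sum_primeFinset_one_div_le hγ]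
    with M hM hsum K _ _ hK D hMD
  have h2 := hM.iterLog_two_pos
  have hA := amplitude_nonneg M
  refine Real.exp_le_exp.2 (add_le_add (neg_le_neg ?_) ?_)
  · have hlog : iterLog 1 M ≤ Real.log D :=
      Real.log_le_log hM.natCast_pos (by exact_mod_cast hMD)
    rw [Real.log_sqrt D.cast_nonneg, div_mul_div_comm, one_mul, mul_comm 2]
    gcongr
  calc _ ≤ ∑ 𝔭 ∈ primeFinset K γ M,
          amplitude M * Real.exp (3 * finrank ℚ K) * (1 / (primeBelow 𝔭 : ℝ)) := by
        refine Finset.sum_le_sum fun 𝔭 h𝔭 => ?_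
        obtain ⟨k, hk, hmem⟩ := mem_primeFinset.1 h𝔭
        have hk1 := one_le_of_mem_shellIndices hk
        have hv : primeValue M 𝔭 / √(Ideal.absNorm 𝔭 : ℝ) ≤ amplitude M * (1 / primeBelow 𝔭) :=
          (primeValue_div_sqrt_le hM hk1 hmem).trans
            (mul_le_mul_of_nonneg_right (div_le_self hA (by exact_mod_cast hk1)) (by positivity))
        have hN := absNorm_rpow_le hM (add_one_le_iterLog_two_of_mem_shellIndices hγ hM hk) hmem
        exact (mul_le_mul hv hN (by positivity) (by positivity)).trans_eq (by ring)
    _ = amplitude M * Real.exp (3 * finrank ℚ K) *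
          ∑ 𝔭 ∈ primeFinset K γ M, 1 / (primeBelow 𝔭 : ℝ) := by rw [Finset.mul_sum]
    _ ≤ amplitude M * Real.exp (3 * d) * (2 * d) := by
        gcongr
        exact (hsum K).trans (by gcongr)
    _ = _ := by ring

section

variable {K : Type*} [Field K] [NumberField K] {γ a : ℝ} {M : ℕ}

theorem sum_goodSets_prod_sq_le :
    ∑ S ∈ goodSets K γ a M, ∏ 𝔭 ∈ S, primeValue M 𝔭 ^ 2 ≤
      ∏ 𝔭 ∈ primeFinset K γ M, (1 + primeValue M 𝔭 ^ 2) := by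
  rw [Finset.prod_one_add]
  exact Finset.sum_le_sum_of_subset_of_nonneg
    (fun S hS => Finset.mem_powerset.2 (subset_primeFinset_of_mem_goodSets hS))
    fun S _ _ => Finset.prod_nonneg fun 𝔭 _ => sq_nonneg _

open Classical in
theorem empty_mem_goodSets (hM : IsLarge M) (ha : 0 < a) : ∅ ∈ goodSets K γ a M := by
  refine Finset.mem_filter.2 ⟨Finset.empty_mem_powerset _, fun k hk => ?_⟩
  have h1 := hM.iterLog_one_pos
  have h3 := hM.iterLog_three_pos
  have hk1 := one_le_of_mem_shellIndices hk
  rw [Finset.filter_empty, Finset.card_empty, Nat.cast_zero, shellBound]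
  positivity

theorem sum_goodSets_prod_sq_pos (hM : IsLarge M) (ha : 0 < a) :
    0 < ∑ S ∈ goodSets K γ a M, ∏ 𝔭 ∈ S, primeValue M 𝔭 ^ 2 :=
  Finset.sum_pos' (fun _ _ => Finset.prod_nonneg fun _ _ => sq_nonneg _)
    ⟨∅, empty_mem_goodSets hM ha, by rw [Finset.prod_empty]; exact one_pos⟩

theorem exp_mul_prod_le_prod_primeFinset (hM : IsLarge M)
    (hA : amplitude M * iterLog 2 M ≤ iterLog 1 M) :
    Real.exp ((1 - 2 * (1 / iterLog 3 M)) * (amplitude M * primeSum K γ M)) *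
        ∏ 𝔭 ∈ primeFinset K γ M, (1 + primeValue M 𝔭 ^ 2) ≤
      ∏ 𝔭 ∈ primeFinset K γ M,
        (1 + (primeValue M 𝔭 ^ 2 + primeValue M 𝔭 / √(Ideal.absNorm 𝔭 : ℝ))) := by
  rw [amplitude_mul_primeSum]
  refine exp_mul_prod_one_add_le _ (fun _ _ => sq_nonneg _) (fun 𝔭 h𝔭 => ?_) (fun 𝔭 h𝔭 => ?_)
    fun 𝔭 h𝔭 => ?_ <;> obtain ⟨k, hk, hmem⟩ := mem_primeFinset.1 h𝔭 <;>
    have hk1 := one_le_of_mem_shellIndices hk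
  exacts [primeValue_div_sqrt_nonneg hM hmem, primeValue_sq_le_one_div hM hk1 hmem,
    primeValue_div_sqrt_le_one_div hM hA hk1 hmem]

end

open Classical in
theorem exists_eventually_le_resonanceRatio {γ a : ℝ} {d : ℕ} (hγ : γ ≤ 1) (hd : 0 < d)
    (ha : d < a) :
    ∃ c > 0, ∃ C > 0, ∀ᶠ M : ℕ in atTop, ∀ (K : Type*) [Field K] [NumberField K],
      finrank ℚ K ≤ d → ∀ D : ℕ, M ≤ D →
        Real.exp ((1 - 2 * (1 / iterLog 3 M)) * (amplitude M * primeSum K γ M)) *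
          (1 - shellError c M - normError C M) ≤ resonanceRatio K γ a M D := by
  have hd0 : (0 : ℝ) < d := by exact_mod_cast hd
  obtain ⟨c, hc, hshell⟩ := exists_eventually_sum_exp_shellBound_le hγ hd ha
  have hC : 0 < 2 * d * Real.exp (3 * d) := by positivity
  refine ⟨c, hc, _, hC, ?_⟩
  have herror := ((tendsto_shellError hc).const_sub 1).sub (tendsto_normError hC)
  rw [sub_zero, sub_zero] at herror
  filter_upwards [eventually_isLarge, eventually_amplitude_mul_iterLog_two_le one_pos, hshell,
    eventually_exp_norm_le hγ d, herror.eventually_const_le one_pos]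
    with M hM hA hshell hnorm hE K _ _ hK D hMD
  rw [one_mul] at hA
  set E := 1 - shellError c M - normError (2 * d * Real.exp (3 * d)) M
  have hv : ∀ 𝔭 ∈ primeFinset K γ M, 0 ≤ primeValue M 𝔭 / √(Ideal.absNorm 𝔭 : ℝ) := by
    intro 𝔭 h𝔭
    obtain ⟨k, -, hk⟩ := mem_primeFinset.1 h𝔭
    exact primeValue_div_sqrt_nonneg hM hk
  have hX : 0 < √(D : ℝ) :=
    Real.sqrt_pos.2 (hM.natCast_pos.trans_le (by exact_mod_cast hMD))
  have hrankin := prod_one_add_mul_one_sub_le_sum (primeFinset K γ M)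
    (u := fun 𝔭 => primeValue M 𝔭 ^ 2) (fun _ _ => sq_nonneg _) hv
    (fun 𝔭 _ => (Ideal.absNorm 𝔭).cast_nonneg) hX (one_div_nonneg.2 hM.iterLog_two_pos.le)
    (shellIndices γ M) (fun k 𝔭 => 𝔭 ∈ shellPrimes K M k) (shellBound a M)
    ((one_le_div hd0).2 ha.le)
  rw [resonanceRatio, finsum_resonator_sq, finsum_resonancePairs, one_div_mul_eq_div,
    le_div_iff₀ (sum_goodSets_prod_sq_pos hM (hd0.trans ha))]
  calc _ ≤ Real.exp ((1 - 2 * (1 / iterLog 3 M)) * (amplitude M * primeSum K γ M)) * E *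
          ∏ 𝔭 ∈ primeFinset K γ M, (1 + primeValue M 𝔭 ^ 2) :=
        mul_le_mul_of_nonneg_left sum_goodSets_prod_sq_le (mul_nonneg (Real.exp_pos _).le hE)
    _ ≤ (∏ 𝔭 ∈ primeFinset K γ M,
          (1 + (primeValue M 𝔭 ^ 2 + primeValue M 𝔭 / √(Ideal.absNorm 𝔭 : ℝ)))) * E := by
        rw [mul_right_comm]
        exact mul_le_mul_of_nonneg_right (exp_mul_prod_le_prod_primeFinset hM hA) hE
    _ ≤ _ := (mul_le_mul_of_nonneg_left (by linarith [hshell K hK, hnorm K hK D hMD])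
          (Finset.prod_nonneg fun 𝔭 h𝔭 => by linarith [hv 𝔭 h𝔭, sq_nonneg (primeValue M 𝔭)])).trans
        hrankin

end LowerBound

end Resonance

end

open Resonance in
theorem proposition3p1_general {γ a : ℝ} {d : ℕ} (hγ : 0 < γ) (hd : 0 < d) (ha : d < a)
    (ha' : a < 1 / γ) :
    ∃ ε₁ ε₂ : ℕ → ℝ, Tendsto ε₁ atTop (𝓝 0) ∧ Tendsto ε₂ atTop (𝓝 0) ∧
      ∃ M₀ : ℕ, ∀ M : ℕ, M₀ ≤ M →
        ∀ (K : Type*) [Field K] [NumberField K], Module.finrank ℚ K ≤ d →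
          (resonatorSet K γ a M).encard ≤ M ∧ ∀ D : ℕ, M ≤ D →
            Real.exp ((1 + ε₁ M) * (amplitude M * primeSum K γ M) + ε₂ M) ≤
              resonanceRatio K γ a M D := by
  have haγ : a * γ < 1 := (lt_div_iff₀ hγ).1 ha'
  have hd1 : (1 : ℝ) ≤ d := by exact_mod_cast hd
  have hγ1 : γ ≤ 1 := by nlinarith
  obtain ⟨c, hc, C, hC, hratio⟩ := exists_eventually_le_resonanceRatio hγ1 hd ha
  have hcard := eventually_card_goodSets_le hγ.le (by linarith : 0 ≤ a) haγ d
  have herr := ((tendsto_shellError hc).const_sub 1).sub (tendsto_normError hC)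
  rw [sub_zero, sub_zero] at herr
  refine ⟨fun M => -(2 * (1 / iterLog 3 M)),
    fun M => Real.log (1 - shellError c M - normError C M), ?_, ?_, ?_⟩
  · simpa using (((tendsto_iterLog_atTop 3).const_div_atTop 1).const_mul 2).neg
  · simpa using herr.log one_ne_zero
  · obtain ⟨M₀, hM₀⟩ := eventually_atTop.1
      ((hratio.and hcard).and (herr.eventually_const_lt one_pos))
    refine ⟨M₀, fun M hM K _ _ hK => ?_⟩
    obtain ⟨⟨hr, hn⟩, hpos⟩ := hM₀ M hM
    refine ⟨?_, fun D hMD => ?_⟩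
    · rw [encard_resonatorSet]
      exact_mod_cast hn K hK
    · rw [Real.exp_add, Real.exp_log hpos, ← sub_eq_add_neg]
      exact hr K hK D hMD

theorem proposition3p1 (γ a : ℝ) (hγ : 0 < γ) (hγ' : γ < 1 / 2) (ha : 2 < a) (ha' : a < 1 / γ) :
    ∃ ε₁ ε₂ : ℕ → ℝ, Tendsto ε₁ atTop (𝓝 0) ∧ Tendsto ε₂ atTop (𝓝 0) ∧
      ∃ M₀ : ℕ, ∀ M : ℕ, M₀ ≤ M →
        ∀ D : ℕ, Resonance.IsFundamentalDiscriminant (-(D : ℤ)) →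
          ∀ (K : Type*) [Field K] [NumberField K], Resonance.IsQSqrtNeg D K →
            (Resonance.resonatorSet K γ a M).encard ≤ M ∧
            (M ≤ D →
              Real.exp ((1 + ε₁ M) * (Resonance.amplitude M * Resonance.primeSum K γ M) + ε₂ M) ≤
                Resonance.resonanceRatio K γ a M D) := by
  obtain ⟨ε₁, ε₂, h₁, h₂, M₀, h⟩ := proposition3p1_general hγ two_pos (by exact_mod_cast ha) ha'
  exact ⟨ε₁, ε₂, h₁, h₂, M₀, fun M hM D _ K _ _ hK =>
    (h M hM K hK.finrank_le_two).imp_right fun h => h D⟩
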